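/- There is a universal constant $\varepsilon_0\in(0,\pi/6)$ such that the following holds for every $0<\varepsilon<\varepsilon_0$. Let $v_2\colon[0,\infty)\to\mathbb{R}\cup\{+\infty\}$ satisfy - (i$_2$) $\min_{r\ge 0}v_2(r)=v_2(1)=-1$ and $v_2(r)>-1$ for $r\ne 1$; - (ii$_2$) there is $r_0$ with $1<r_0<\sqrt2$ and $v_2(r)=0$ for all $r\ge r_0$ (any such $r_0$ is fixed); - (iii$_2$) $v_2(r)>\varepsilon^{-1}$ for all $r\in[0,1-\varepsilon]$; and let $v_3\colon[0,2\pi]\to\mathbb{R}$ satisfy - (i$_3$) $v_3(\theta)=v_3(2\pi-\theta)$ for all $\theta\in[0,2\pi]$; - (ii$_3$) $v_3(k\pi/2)=0$ for $k=1,2,3$, and $v_3(\theta)>0$ for $\theta\notin\{\pi/2,\pi,3\pi/2\}$; - (iii$_3$) $v_3(\theta)\ge 4(\pi/6-\varepsilon)^{-1}|\theta-\pi|$ for all $\theta\in[\pi-\varepsilon,\pi+\varepsilon]$, with equality only if $\theta=\pi$; - (iv$_3$) $v_3(\theta)>\frac{4}{(1-\varepsilon)^2}\big(\sqrt2+\tfrac12\big)^2$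 for all $\theta\in[0,2\pi]$ outside $[\pi/2-\varepsilon,\pi/2+\varepsilon]\cup[\pi-\varepsilon,\pi+\varepsilon]\cup[3\pi/2-\varepsilon,3\pi/2+\varepsilon]$. For a configuration $C_n=(x_1,\dots,x_n)\in(\mathbb{R}^2)^n$ define the energy $$\mathcal{F}(C_n)=\frac12\sum_{i\ne j}v_2(|x_i-x_j|)+\frac12\sum_{(i,j,k)}v_3(\theta_{i,j,k}),$$ where the second sum runs over the ordered triples $(i,j,k)$ of pairwise distinct indices such that $0<|x_i-x_j|\le r_0$ and $0<|x_i-x_k|\le r_0$, and $\theta_{i,j,k}\in[0,2\pi)$ is the angle from $x_j-x_i$ to $x_k-x_i$, measured clockwise. Then for every $n$ and every $C_n\in(\mathbb{R}^2)^n$, $$\mathcal{F}(C_n)\ge -2n+\lceil 2\sqrt n\rceil,$$ and equality holds only if some rigid motion of the plane maps all the points $x_1,\dots,x_n$ into $\mathbb{Z}^2$. -/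

import Mathlib

namespace Crystallization

/-- The Euclidean plane. -/
abbrev Plane : Type := EuclideanSpace ℝ (Fin 2)

/-- A vector of the plane, as a complex number. -/
noncomputable def toComplex (u : Plane) : ℂ := ⟨u 0, u 1⟩

/-- The angle at `y`, in `[0, 2π)`, swept out when the vector `x - y` is turned clockwise until it
has the direction of `z - y` (meaningful for `x ≠ y` and `z ≠ y`). -/
noncomputable def clockwiseAngle (x y z : Plane) : ℝ :=
  toIcoMod Real.two_pi_pos 0 (Complex.arg (toComplex (x - y) / toComplex (z - y)))

/-- The assumptions on the two-body potential `v₂ : [0, ∞) → ℝ ∪ {+∞}` with parameter `ε` and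
interaction range `r₀`. Only the values at `r ≥ 0` matter, and `min_eq` and `min_unique`
exclude the value `-∞` there. -/
structure IsTwoBodyPotential (ε r₀ : ℝ) (v₂ : ℝ → EReal) : Prop where
  min_eq : v₂ 1 = ((-1 : ℝ) : EReal)
  min_unique : ∀ r : ℝ, 0 ≤ r → r ≠ 1 → ((-1 : ℝ) : EReal) < v₂ r
  one_lt_range : 1 < r₀
  range_lt_sqrt_two : r₀ < √2
  eq_zero : ∀ r : ℝ, r₀ ≤ r → v₂ r = 0
  repulsive : ∀ r : ℝ, 0 ≤ r → r ≤ 1 - ε → ((ε⁻¹ : ℝ) : EReal) < v₂ r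

/-- The assumptions on the three-body potential `v₃ : [0, 2π] → ℝ` with parameter `ε`. Only the
values on `[0, 2π]` matter. -/
structure IsThreeBodyPotential (ε : ℝ) (v₃ : ℝ → ℝ) : Prop where
  symm : ∀ θ ∈ Set.Icc (0 : ℝ) (2 * Real.pi), v₃ θ = v₃ (2 * Real.pi - θ)
  zero_half_pi : v₃ (Real.pi / 2) = 0
  zero_pi : v₃ Real.pi = 0
  zero_three_half_pi : v₃ (3 * Real.pi / 2) = 0
  pos : ∀ θ ∈ Set.Icc (0 : ℝ) (2 * Real.pi),
    θ ≠ Real.pi / 2 → θ ≠ Real.pi → θ ≠ 3 * Real.pi / 2 → 0 < v₃ θ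
  slope : ∀ θ ∈ Set.Icc (Real.pi - ε) (Real.pi + ε),
    4 * (Real.pi / 6 - ε)⁻¹ * |θ - Real.pi| ≤ v₃ θ
  slope_strict : ∀ θ ∈ Set.Icc (Real.pi - ε) (Real.pi + ε),
    v₃ θ = 4 * (Real.pi / 6 - ε)⁻¹ * |θ - Real.pi| → θ = Real.pi
  large : ∀ θ ∈ Set.Icc (0 : ℝ) (2 * Real.pi),
    θ ∉ Set.Icc (Real.pi / 2 - ε) (Real.pi / 2 + ε) ∪ Set.Icc (Real.pi - ε) (Real.pi + ε) ∪
        Set.Icc (3 * Real.pi / 2 - ε) (3 * Real.pi / 2 + ε) →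
      4 / (1 - ε) ^ 2 * (√2 + 1 / 2) ^ 2 < v₃ θ

/-- Two points form a bond if they are different and their distance is at most `r₀`. -/
def IsBond (r₀ : ℝ) (x y : Plane) : Prop := x ≠ y ∧ dist x y ≤ r₀

open Classical in
/-- The two-body part of the energy: half the sum over all ordered pairs of distinct indices. -/
noncomputable def twoBodyEnergy (v₂ : ℝ → EReal) {n : ℕ} (C : Fin n → Plane) : EReal :=
  ((1 / 2 : ℝ) : EReal) * ∑ i, ∑ j, if i ≠ j then v₂ (dist (C i) (C j)) else 0

open Classical in
/-- The three-body part of the energy: half the sum over all ordered triples `(i, j, k)` with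
`j ≠ k` for which both `x_j` and `x_k` are bonded to `x_i`, of `v₃` of the bond angle at `x_i`. -/
noncomputable def threeBodyEnergy (v₃ : ℝ → ℝ) (r₀ : ℝ) {n : ℕ} (C : Fin n → Plane) : ℝ :=
  (1 / 2) * ∑ i, ∑ j, ∑ k,
    if j ≠ k ∧ IsBond r₀ (C i) (C j) ∧ IsBond r₀ (C i) (C k) then
      v₃ (clockwiseAngle (C j) (C i) (C k))
    else 0

/-- The configurational energy, with values in `ℝ ∪ {+∞}`. -/
noncomputable def energy (v₂ : ℝ → EReal) (v₃ : ℝ → ℝ) (r₀ : ℝ) {n : ℕ} (C : Fin n → Plane) :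
    EReal :=
  twoBodyEnergy v₂ C + ((threeBodyEnergy v₃ r₀ C : ℝ) : EReal)

/-- The square lattice `ℤ²` in the plane. -/
def squareLattice : Set Plane := {x | ∀ i, ∃ k : ℤ, x i = k}

end Crystallization

/-!
Removing a particle with positive removal energy lowers the energy, and the claimed bound does not
increase with `n`, so by induction one may assume that no particle has positive removal energy. The
repulsion at short distances and the three-body energy of skew angles then outweigh all attraction,
so particles are never too close and any two bonds at a particle are nearly orthogonal or nearly
opposite.

Classify directions, up to sign, by five double cones of opening angle `π / 5` counted from a phase
`t`. The bonds of one class form strings that never turn back. Each particle lies on two strings of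
orthogonal classes. Orthogonality of classes is a five-cycle, hence triangle-free, so Mantel's
theorem shows that `n` particles need at least `2 * √n` strings. A string ends at a particle without
an outgoing bond of its class, so there are at most `2 * n - ⌈2 * √n⌉` bonds plus the bonds whose
class differs from that of a nearly opposite one. A pair of nearly opposite bonds is separated by a
random phase with probability `5 / π` times its deviation from a straight angle, so for some `t` the
three-body energy pays for the surplus bonds.

Equality forces unit bonds and exact right angles. It also forces a connected bond graph, since the
minimal energy is strictly subadditive. Hence all positions differ by Gaussian integer multiples of
one unit vector.
-/

namespace Crystallization

open Finset

section Mantel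

theorem four_mul_card_edgeFinset_le_sq {L : Type*} [Fintype L] {G : SimpleGraph L}
    [DecidableRel G.Adj] (hG : G.CliqueFree 3) : 4 * #G.edgeFinset ≤ Fintype.card L ^ 2 := by
  have turan := SimpleGraph.CliqueFree.card_edgeFinset_le (r := 2) hG
  have choose_eq_zero : (Fintype.card L % 2).choose 2 = 0 :=
    Nat.choose_eq_zero_of_lt (Nat.mod_lt _ two_pos)
  simp only [choose_eq_zero, add_zero, Nat.add_one_sub_one, mul_one] at turan
  calc 4 * #G.edgeFinset ≤ 4 * ((Fintype.card L ^ 2 - (Fintype.card L % 2) ^ 2) / 4) := by gcongr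
    _ ≤ Fintype.card L ^ 2 := (Nat.mul_div_le _ 4).trans (Nat.sub_le _ _)

theorem cliqueFree_three_of_hom {L Q : Type*} {G : SimpleGraph L} {H : SimpleGraph Q}
    (c : G →g H) (hH : H.CliqueFree 3) : G.CliqueFree 3 := by
  classical
  intro s hs
  obtain ⟨x, y, z, hxy, hxz, hyz, -⟩ := SimpleGraph.is3Clique_iff.1 hs
  exact hH {c x, c y, c z} <|
    SimpleGraph.is3Clique_triple_iff.2 ⟨c.map_rel hxy, c.map_rel hxz, c.map_rel hyz⟩

theorem four_mul_card_le_sq_card_image_union {V L Q : Type*} [Fintype V] [DecidableEq L]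
    {H : SimpleGraph Q} (hH : H.CliqueFree 3) (c : L → Q) {x y : V → L}
    (hadj : ∀ i, H.Adj (c (x i)) (c (y i))) (hinj : Function.Injective fun i => s(x i, y i)) :
    4 * Fintype.card V ≤ #(univ.image x ∪ univ.image y) ^ 2 := by
  classical
  set T := univ.image x ∪ univ.image y
  have hx (i) : x i ∈ T := mem_union_left _ (mem_image_of_mem x (mem_univ i))
  have hy (i) : y i ∈ T := mem_union_right _ (mem_image_of_mem y (mem_univ i))
  let edge (i : V) : Sym2 T := s(⟨x i, hx i⟩, ⟨y i, hy i⟩)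
  let G : SimpleGraph T := H.comap fun l => c l
  have edge_mem (i) : edge i ∈ G.edgeFinset := by
    simpa [edge, G] using hadj i
  have edge_injective : Function.Injective edge := fun i j hij =>
    hinj (congrArg (Sym2.map Subtype.val) hij)
  calc 4 * Fintype.card V ≤ 4 * #G.edgeFinset :=
        Nat.mul_le_mul_left 4 <| card_le_card_of_injOn edge (fun i _ => edge_mem i)
          edge_injective.injOn
    _ ≤ Fintype.card T ^ 2 := four_mul_card_edgeFinset_le_sq <|
        cliqueFree_three_of_hom (H := H) ⟨fun l : T => c l, fun h => h⟩ hH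
    _ = #T ^ 2 := by rw [Fintype.card_coe]

end Mantel

/-- A classification of the bonds of the graph `G` by direction: `R q i j` expresses that the
displacement from `i` to `j` lies in the cone attached to the class `q`. The cones are convex,
cones of different classes meet neither each other nor each other's negatives, and two bonds at the
same vertex never point into the same cone. -/
structure DirectionClasses {V Q : Type*} (G : SimpleGraph V) (R : Q → V → V → Prop) : Prop where
  trans : ∀ {q i j k}, R q i j → R q j k → R q i k
  irrefl : ∀ {q i}, ¬ R q i i
  unique : ∀ {q q' i j}, R q i j ∨ R q j i → R q' i j ∨ R q' j i → q = q'
  exists_class : ∀ {i j}, G.Adj i j → ∃ q, R q i j ∨ R q j i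
  out_unique : ∀ {q i j k}, G.Adj i j → G.Adj i k → R q i j → R q i k → j = k
  in_unique : ∀ {q i j k}, G.Adj i j → G.Adj i k → R q j i → R q k i → j = k

namespace DirectionClasses

open Relation

variable {V Q : Type*} {G : SimpleGraph V} {R : Q → V → V → Prop}

/-- `Outgoing G R q i` means that some bond at `i` points into the cone of class `q`. -/
def Outgoing (G : SimpleGraph V) (R : Q → V → V → Prop) (q : Q) (i : V) : Prop :=
  ∃ j, G.Adj i j ∧ R q i j

/-- `Incident G R q i` means that some bond at `i` has class `q`, in one of its two orientations. -/
def Incident (G : SimpleGraph V) (R : Q → V → V → Prop) (q : Q) (i : V) : Prop :=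
  ∃ j, G.Adj i j ∧ (R q i j ∨ R q j i)

/-- `Stray G R a b q i` means that some bond at `i` has a class `q` which is neither of the two
classes `a i` and `b i` chosen at `i`. -/
def Stray (G : SimpleGraph V) (R : Q → V → V → Prop) (a b : V → Q) (q : Q) (i : V) : Prop :=
  Incident G R q i ∧ ¬ (q = a i ∨ q = b i)

theorem Outgoing.incident {q : Q} {i : V} (h : Outgoing G R q i) : Incident G R q i :=
  let ⟨j, hj, hR⟩ := h
  ⟨j, hj, Or.inl hR⟩

/-- A step from `i` to `j` along a bond of class `q`. The maximal paths of such steps are the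
strings of the configuration in the direction `q`. -/
def Step (G : SimpleGraph V) (R : Q → V → V → Prop) (q : Q) (i j : V) : Prop :=
  G.Adj i j ∧ R q i j

theorem eq_or_rel_of_reflTransGen (h : DirectionClasses G R) {q : Q} {i j : V}
    (hij : ReflTransGen (Step G R q) i j) : j = i ∨ R q i j := by
  induction hij with
  | refl => exact Or.inl rfl
  | tail _ hstep ih =>
    rcases ih with rfl | ih
    · exact Or.inr hstep.2
    · exact Or.inr (h.trans ih hstep.2)

theorem exists_string_end [Finite V] (h : DirectionClasses G R) (q : Q) (i : V) :
    ∃ e, ReflTransGen (Step G R q) i e ∧ ¬ Outgoing G R q e := by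
  have : IsTrans V (Function.swap (R q)) := ⟨fun _ _ _ hab hbc => h.trans hbc hab⟩
  have : Std.Irrefl (Function.swap (R q)) := ⟨fun _ => h.irrefl⟩
  induction i using (Finite.wellFounded_of_trans_of_irrefl (Function.swap (R q))).induction with
  | _ i ih =>
    by_cases hi : Outgoing G R q i
    · obtain ⟨j, hj⟩ := hi
      obtain ⟨e, hje, he⟩ := ih j hj.2
      exact ⟨e, ReflTransGen.head hj hje, he⟩
    · exact ⟨i, ReflTransGen.refl, hi⟩

theorem eq_or_comparable_of_common_end (h : DirectionClasses G R) {q : Q} {i j e : V}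
    (hi : ReflTransGen (Step G R q) i e) (hj : ReflTransGen (Step G R q) j e) :
    i = j ∨ R q i j ∨ R q j i := by
  have step_left_unique : Relator.RightUnique (Function.swap (Step G R q)) :=
    fun _ _ _ hb hc => h.in_unique hb.1.symm hc.1.symm hb.2 hc.2
  rcases ReflTransGen.total_of_right_unique step_left_unique (reflTransGen_swap.2 hi)
      (reflTransGen_swap.2 hj) with hij | hij <;>
    rcases h.eq_or_rel_of_reflTransGen (reflTransGen_swap.1 hij) with heq | hR <;> tauto

theorem eq_of_common_ends (h : DirectionClasses G R) {q q' : Q} (hq : q ≠ q') {i j e e' : V}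
    (hi : ReflTransGen (Step G R q) i e) (hj : ReflTransGen (Step G R q) j e)
    (hi' : ReflTransGen (Step G R q') i e') (hj' : ReflTransGen (Step G R q') j e') : i = j := by
  rcases h.eq_or_comparable_of_common_end hi hj with rfl | hR
  · rfl
  · exact (h.eq_or_comparable_of_common_end hi' hj').resolve_right fun hR' => hq (h.unique hR hR')

theorem incident_or_eq_of_string_end {q : Q} {i e : V}
    (hie : ReflTransGen (Step G R q) i e) : Incident G R q e ∨ e = i := by
  rcases hie.cases_tail with rfl | ⟨j, -, hj⟩
  · exact Or.inr rfl
  · exact Or.inl ⟨j, hj.1.symm, Or.inr hj.2⟩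

open Classical in
theorem card_edgeFinset_le_card_outgoing [Fintype V] [Fintype Q] (h : DirectionClasses G R) :
    #G.edgeFinset ≤ #{x : V × Q | Outgoing G R x.2 x.1} := by
  refine card_le_card_of_forall_subsingleton
    (fun e x => ∃ j, e = s(x.1, j) ∧ Step G R x.2 x.1 j) (fun e he => ?_) ?_
  · induction e with | _ i j =>
    have hij : G.Adj i j := by simpa using he
    obtain ⟨q, hq | hq⟩ := h.exists_class hij
    · exact ⟨(i, q), by simpa using ⟨j, hij, hq⟩, j, rfl, hij, hq⟩
    · exact ⟨(j, q), by simpa using ⟨i, hij.symm, hq⟩, i, Sym2.eq_swap, hij.symm, hq⟩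
  · rintro x - _ ⟨-, j, rfl, hj⟩ _ ⟨-, k, rfl, hk⟩
    rw [h.out_unique hj.1 hk.1 hj.2 hk.2]

theorem labels_injective {e : Q → V → V}
    (h : DirectionClasses G R) (he : ∀ q i, ReflTransGen (Step G R q) i (e q i)) {a b : V → Q}
    (hab : ∀ i, a i ≠ b i) :
    Function.Injective fun i => s((e (a i) i, a i), (e (b i) i, b i)) := by
  intro i j hij
  have common_ends : e (a i) i = e (a i) j ∧ e (b i) i = e (b i) j := by
    rcases Sym2.eq_iff.1 hij with ⟨hA, hB⟩ | ⟨hA, hB⟩ <;>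
      · obtain ⟨hA, hqA⟩ := Prod.ext_iff.1 hA
        obtain ⟨hB, hqB⟩ := Prod.ext_iff.1 hB
        dsimp only at hA hqA hB hqB
        rw [hA, hB, hqA, hqB]
        exact ⟨rfl, rfl⟩
  exact h.eq_of_common_ends (hab i) (he _ i) (common_ends.1 ▸ he _ j) (he _ i)
    (common_ends.2 ▸ he _ j)

open Classical in
theorem card_filter_eq_or_eq_le [Fintype V] [Fintype Q] (a b : V → Q) :
    #{x : V × Q | x.2 = a x.1 ∨ x.2 = b x.1} ≤ 2 * Fintype.card V := by
  have subset_images : ({x : V × Q | x.2 = a x.1 ∨ x.2 = b x.1} : Finset (V × Q)) ⊆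
      univ.image (fun i => (i, a i)) ∪ univ.image fun i => (i, b i) := by
    rintro ⟨i, q⟩ hq
    simpa [eq_comm] using hq
  calc _ ≤ Fintype.card V + Fintype.card V := (card_le_card subset_images).trans <|
        (card_union_le _ _).trans (add_le_add card_image_le card_image_le)
    _ = 2 * Fintype.card V := (two_mul _).symm

-- Label the vertex `i` by the ends of the strings of classes `a i` and `b i` through it. The pair
-- of labels determines `i`, and labels of the same kind are never paired, so Mantel's theorem
-- bounds the number of labels from below.
open Classical in
theorem exists_four_mul_card_le_sq [Fintype V] [Fintype Q] {H : SimpleGraph Q}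
    (h : DirectionClasses G R) (hH : H.CliqueFree 3) {a b : V → Q} (hab : ∀ i, H.Adj (a i) (b i)) :
    ∃ P : ℕ, 4 * Fintype.card V ≤ P ^ 2 ∧ P + #G.edgeFinset ≤ 2 * Fintype.card V +
      #{x : V × Q | Stray G R a b x.2 x.1} := by
  choose e he hend using h.exists_string_end
  refine ⟨_, four_mul_card_le_sq_card_image_union hH Prod.snd (x := fun i => (e (a i) i, a i))
    (y := fun i => (e (b i) i, b i)) hab (h.labels_injective he fun i => (hab i).ne), ?_⟩
  set labels := univ.image (fun i => (e (a i) i, a i)) ∪ univ.image (fun i => (e (b i) i, b i))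
  let incident : Finset (V × Q) := {x | Incident G R x.2 x.1}
  let outgoing : Finset (V × Q) := {x | Outgoing G R x.2 x.1}
  let chosen : Finset (V × Q) := {x | x.2 = a x.1 ∨ x.2 = b x.1}
  have labels_subset : labels ⊆ (incident \ outgoing) ∪ (chosen \ incident) := by
    have end_mem {q : Q} {i : V} (hq : q = a i ∨ q = b i) :
        (e q i, q) ∈ (incident \ outgoing) ∪ (chosen \ incident) := by
      have hinc := incident_or_eq_of_string_end (he q i)
      simp only [mem_union, mem_sdiff, incident, outgoing, chosen, mem_filter_univ]
      by_cases hI : Incident G R q (e q i)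
      · exact Or.inl ⟨hI, hend q i⟩
      · exact Or.inr ⟨by rwa [hinc.resolve_left hI], hI⟩
    simp only [labels, union_subset_iff, image_subset_iff]
    exact ⟨fun i _ => end_mem (Or.inl rfl), fun i _ => end_mem (Or.inr rfl)⟩
  have card_labels : #labels ≤ #(incident \ outgoing) + #(chosen \ incident) :=
    (card_le_card labels_subset).trans (card_union_le _ _)
  have card_edges : #G.edgeFinset ≤ #outgoing := h.card_edgeFinset_le_card_outgoing
  have card_incident : #(incident \ outgoing) + #outgoing = #incident :=
    card_sdiff_add_card_eq_card (monotone_filter_right _ fun _ _ => Outgoing.incident)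
  have card_exchange : #(chosen \ incident) + #incident = #(incident \ chosen) + #chosen := by
    rw [card_sdiff_add_card, card_sdiff_add_card, union_comm]
  have card_chosen : #chosen ≤ 2 * Fintype.card V := card_filter_eq_or_eq_le a b
  have stray_eq : ({x : V × Q | Stray G R a b x.2 x.1} : Finset (V × Q)) = incident \ chosen := by
    ext
    simp [Stray, incident, chosen]
  rw [stray_eq]
  omega

end DirectionClasses

section Averaging

open MeasureTheory

theorem intervalIntegrable_floor_sub (y a b : ℝ) :
    IntervalIntegrable (fun s : ℝ => (⌊y - s⌋ : ℝ)) volume a b :=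
  AntitoneOn.intervalIntegrable fun _ _ _ _ hst =>
    Int.cast_le.2 (Int.floor_mono (sub_le_sub_left hst y))

theorem integral_fract_sub (y : ℝ) :
    ∫ s in (0 : ℝ)..1, Int.fract (y - s) = ∫ s in (0 : ℝ)..1, Int.fract s := by
  have hper : Function.Periodic (Int.fract : ℝ → ℝ) 1 := Int.fract_periodic ℝ
  rw [intervalIntegral.integral_comp_sub_left]
  simpa using hper.intervalIntegral_add_eq (y - 1) 0

theorem integral_floor_sub_sub_floor_sub (x y : ℝ) :
    ∫ s in (0 : ℝ)..1, ((⌊y - s⌋ : ℝ) - ⌊x - s⌋) = y - x := by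
  have integrable_fract (z : ℝ) :
      IntervalIntegrable (fun s : ℝ => Int.fract (z - s)) volume 0 1 :=
    ((continuous_const.sub continuous_id).intervalIntegrable 0 1).sub
      (intervalIntegrable_floor_sub z 0 1)
  calc ∫ s in (0 : ℝ)..1, ((⌊y - s⌋ : ℝ) - ⌊x - s⌋)
      = ∫ s in (0 : ℝ)..1, ((y - x) - (Int.fract (y - s) - Int.fract (x - s))) := by
        congr! 2 with s
        rw [← Int.self_sub_fract, ← Int.self_sub_fract]
        ring
    _ = y - x := by
        rw [intervalIntegral.integral_sub (by simp)
          ((integrable_fract y).sub (integrable_fract x)),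
          intervalIntegral.integral_sub (integrable_fract y) (integrable_fract x),
          integral_fract_sub, integral_fract_sub]
        simp

theorem integral_abs_floor_sub_sub_floor_sub (x y : ℝ) :
    ∫ s in (0 : ℝ)..1, |(⌊y - s⌋ : ℝ) - ⌊x - s⌋| = |y - x| := by
  wlog hxy : x ≤ y generalizing x y
  · rw [abs_sub_comm y x, ← this y x (le_of_not_ge hxy)]
    simp only [abs_sub_comm]
  have floor_le (s : ℝ) : (⌊x - s⌋ : ℝ) ≤ ⌊y - s⌋ :=
    Int.cast_le.2 (Int.floor_mono (sub_le_sub_right hxy s))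
  simp only [abs_of_nonneg (sub_nonneg.2 (floor_le _)), abs_of_nonneg (sub_nonneg.2 hxy),
    integral_floor_sub_sub_floor_sub]

theorem exists_sum_abs_floor_sub_le {ι : Type*} (A : Finset ι) (x y : ι → ℝ) :
    ∃ s : ℝ, ∑ a ∈ A, |(⌊y a - s⌋ : ℝ) - ⌊x a - s⌋| ≤ ∑ a ∈ A, |y a - x a| := by
  have integrable (a : ι) :
      IntervalIntegrable (fun s : ℝ => |(⌊y a - s⌋ : ℝ) - ⌊x a - s⌋|) volume 0 1 :=
    ((intervalIntegrable_floor_sub _ _ _).sub (intervalIntegrable_floor_sub _ _ _)).abs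
  have : IsProbabilityMeasure (volume.restrict (Set.Ioc (0 : ℝ) 1)) := ⟨by simp⟩
  obtain ⟨s, hs⟩ := exists_le_integral
    (μ := volume.restrict (Set.Ioc (0 : ℝ) 1)) (integrable_finsetSum A fun a _ => (integrable a).1)
  refine ⟨s, hs.trans_eq ?_⟩
  rw [← intervalIntegral.integral_of_le zero_le_one,
    intervalIntegral.integral_finsetSum fun a _ => integrable a]
  simp only [integral_abs_floor_sub_sub_floor_sub]

theorem exists_card_floor_sub_ne_le {ι : Type*} (A : Finset ι) (x y : ι → ℝ) :
    ∃ s : ℝ, (#{a ∈ A | ⌊y a - s⌋ ≠ ⌊x a - s⌋} : ℝ) ≤ ∑ a ∈ A, |y a - x a| := by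
  obtain ⟨s, hs⟩ := exists_sum_abs_floor_sub_le A x y
  refine ⟨s, le_trans ?_ hs⟩
  rw [natCast_card_filter]
  gcongr with a
  split_ifs with hne
  · exact_mod_cast Int.one_le_abs (sub_ne_zero.2 hne)
  · exact abs_nonneg _

end Averaging

section Sectors

open Complex
open scoped Real

/-- The unit vector whose argument is `x` times `π / 5`. -/
noncomputable def ray (x : ℝ) : ℂ := exp ((x * (π / 5) : ℝ) * I)

/-- The argument in units of `π / 5`, so that `u` lies on the ray of `phase u`. -/
noncomputable def phase (u : ℂ) : ℝ := arg u / (π / 5)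

/-- One of ten half-open cones of opening angle `π / 5`, with phases in `[s, s + 1)`. It is written
as an intersection of half-planes to make it visibly convex. -/
def InCone (s : ℝ) (u : ℂ) : Prop :=
  0 ≤ (u * ray (-s)).im ∧ (u * ray (-s - 1)).im < 0

/-- The direction class of `u`: opposite cones form one class, and the classes are counted from the
phase `t`. -/
noncomputable def sector (t : ℝ) (u : ℂ) : ZMod 5 := (⌊phase u - t⌋ : ℤ)

theorem ray_mul_ray (x y : ℝ) : ray x * ray y = ray (x + y) := by
  rw [ray, ray, ← exp_add, ray]
  push_cast
  ring_nf

theorem ray_im (x : ℝ) : (ray x).im = Real.sin (x * (π / 5)) := exp_ofReal_mul_I_im _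

theorem ray_five : ray 5 = -1 := by
  rw [ray, mul_div_cancel₀ _ (by norm_num), exp_pi_mul_I]

theorem norm_mul_ray_phase (u : ℂ) : ‖u‖ * ray (phase u) = u := by
  rw [ray, phase, div_mul_cancel₀ _ (by positivity), norm_mul_exp_arg_mul_I]

theorem InCone.add {s : ℝ} {u v : ℂ} (hu : InCone s u) (hv : InCone s v) : InCone s (u + v) := by
  simp only [InCone, add_mul, add_im]
  exact ⟨add_nonneg hu.1 hv.1, add_neg hu.2 hv.2⟩

theorem InCone.ne_zero {s : ℝ} {u : ℂ} (hu : InCone s u) : u ≠ 0 := by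
  rintro rfl
  simpa using hu.2

theorem ray_window_of_mem_Ico {y : ℝ} (hy : y ∈ Set.Ico 0 10) :
    0 ≤ (ray y).im ∧ (ray (y - 1)).im < 0 ↔ ⌊y⌋ = 0 := by
  obtain ⟨hy₀, hy₁⟩ := hy
  have hπ : 0 < π := Real.pi_pos
  simp only [ray_im]
  rw [Int.floor_eq_zero_iff]
  constructor
  · rintro ⟨h₀, h₁⟩
    refine ⟨hy₀, ?_⟩
    by_contra! hy
    rcases le_or_gt y 5 with hy' | hy'
    · exact h₁.not_ge (Real.sin_nonneg_of_nonneg_of_le_pi (by nlinarith) (by nlinarith))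
    · refine h₀.not_gt ?_
      rw [← Real.sin_sub_two_pi]
      exact Real.sin_neg_of_neg_of_neg_pi_lt (by nlinarith) (by nlinarith)
  · rintro ⟨-, hy⟩
    exact ⟨Real.sin_nonneg_of_nonneg_of_le_pi (by nlinarith) (by nlinarith),
      Real.sin_neg_of_neg_of_neg_pi_lt (by nlinarith) (by nlinarith)⟩

theorem ray_add_ten_mul_int (x : ℝ) (N : ℤ) : ray (x + 10 * N) = ray x := by
  have angle_eq : (((x + 10 * N) * (π / 5) : ℝ) : ℂ) * I =
      (x * (π / 5) : ℝ) * I + N * (2 * π * I) := by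
    push_cast
    ring
  rw [ray, angle_eq, exp_periodic.int_mul N, ray]

theorem ray_window {x : ℝ} :
    0 ≤ (ray x).im ∧ (ray (x - 1)).im < 0 ↔ ∃ N : ℤ, ⌊x⌋ = 10 * N := by
  set K := ⌊x / 10⌋
  obtain ⟨y, hy⟩ : ∃ y, x = y + 10 * K := ⟨x - 10 * K, by ring⟩
  have hy_mem : y ∈ Set.Ico 0 10 := by
    constructor <;> linarith [Int.floor_le (x / 10), Int.lt_floor_add_one (x / 10)]
  have floor_eq : ⌊x⌋ = ⌊y⌋ + 10 * K := by
    rw [hy]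
    exact_mod_cast Int.floor_add_intCast y (10 * K)
  have floor_nonneg : 0 ≤ ⌊y⌋ := Int.floor_nonneg.2 hy_mem.1
  have floor_lt : ⌊y⌋ < 10 := Int.floor_lt.2 (mod_cast hy_mem.2)
  rw [hy, add_sub_right_comm, ray_add_ten_mul_int, ray_add_ten_mul_int,
    ray_window_of_mem_Ico hy_mem, ← hy, floor_eq]
  exact ⟨fun h => ⟨K, by rw [h, zero_add]⟩, fun ⟨_, _⟩ => by omega⟩

theorem inCone_mul_ray_iff {s r x : ℝ} (hr : 0 < r) :
    InCone s (r * ray x) ↔ ∃ N : ℤ, ⌊x - s⌋ = 10 * N := by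
  rw [InCone, mul_assoc, mul_assoc, ray_mul_ray, ray_mul_ray, im_ofReal_mul, im_ofReal_mul,
    mul_nonneg_iff_of_pos_left hr, ← smul_eq_mul, smul_neg_iff_of_pos_left hr, ← ray_window,
    ← sub_eq_add_neg, add_sub, ← sub_eq_add_neg]

theorem inCone_iff {s : ℝ} {u : ℂ} (hu : u ≠ 0) :
    InCone s u ↔ ∃ N : ℤ, ⌊phase u - s⌋ = 10 * N := by
  rw [← inCone_mul_ray_iff (norm_pos_iff.2 hu), norm_mul_ray_phase]

theorem inCone_neg_iff {s : ℝ} {u : ℂ} (hu : u ≠ 0) :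
    InCone s (-u) ↔ ∃ N : ℤ, ⌊phase u - s⌋ + 5 = 10 * N := by
  rw [← Int.floor_add_ofNat, ← add_sub_right_comm, ← inCone_mul_ray_iff (norm_pos_iff.2 hu),
    ← ray_mul_ray, ray_five, mul_neg_one, mul_neg, norm_mul_ray_phase]

theorem inCone_or_inCone_neg_iff {t : ℝ} {u : ℂ} (hu : u ≠ 0) {q : ZMod 5} :
    InCone (t + q.val) u ∨ InCone (t + q.val) (-u) ↔ sector t u = q := by
  rw [inCone_iff hu, inCone_neg_iff hu, ← sub_sub, Int.floor_sub_natCast, sector]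
  conv_rhs => rw [← ZMod.natCast_zmod_val q, ← Int.cast_natCast, eq_comm,
    ZMod.intCast_eq_intCast_iff_dvd_sub]
  constructor
  · rintro (⟨N, hN⟩ | ⟨N, hN⟩) <;> omega
  · rintro ⟨k, hk⟩
    rcases Int.even_or_odd' k with ⟨N, rfl | rfl⟩
    · exact Or.inl ⟨N, by push_cast at hk ⊢; linarith⟩
    · exact Or.inr ⟨N + 1, by push_cast at hk ⊢; linarith⟩

open InnerProductGeometry

theorem exists_phase_sub_phase_eq {u v : ℂ} (hu : u ≠ 0) (hv : v ≠ 0) :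
    ∃ N : ℤ, phase u - phase v = angle u v / (π / 5) + 10 * N ∨
      phase u - phase v = -(angle u v / (π / 5)) + 10 * N := by
  have coe_eq : ((arg u - arg v : ℝ) : Real.Angle) = (arg (u / v) : ℝ) := by
    rw [Real.Angle.coe_sub, arg_div_coe_angle hu hv]
  obtain ⟨N, hN⟩ := Real.Angle.angle_eq_iff_two_pi_dvd_sub.1 coe_eq
  have phase_eq : phase u - phase v = arg (u / v) / (π / 5) + 10 * N := by
    rw [phase, phase, ← sub_div, sub_eq_iff_eq_add.1 hN]
    field
  rw [angle_eq_abs_arg hu hv, phase_eq]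
  refine ⟨N, ?_⟩
  rcases abs_choice (arg (u / v)) with h | h <;> rw [h]
  · exact Or.inl rfl
  · exact Or.inr (by ring)

theorem angle_lt_of_inCone {s : ℝ} {u v : ℂ} (hu : InCone s u) (hv : InCone s v) :
    angle u v < π / 5 := by
  obtain ⟨M, hM⟩ := (inCone_iff hu.ne_zero).1 hu
  obtain ⟨N, hN⟩ := (inCone_iff hv.ne_zero).1 hv
  obtain ⟨K, hK⟩ := exists_phase_sub_phase_eq hu.ne_zero hv.ne_zero
  rw [Int.floor_eq_iff] at hM hN
  push_cast at hM hN
  have hπ : 0 < π / 5 := by positivity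
  rw [← div_lt_one hπ]
  set x := angle u v / (π / 5)
  have x_nonneg : 0 ≤ x := div_nonneg (angle_nonneg u v) hπ.le
  have x_le : x ≤ 5 := by
    rw [div_le_iff₀ hπ]
    linarith [angle_le_pi u v]
  have same_turn : M - N - K = 0 := by
    have lower : (-1 : ℝ) < (M - N - K : ℤ) := by push_cast; rcases hK with hK | hK <;> linarith
    have upper : ((M - N - K : ℤ) : ℝ) < 1 := by push_cast; rcases hK with hK | hK <;> linarith
    have lower' : -1 < M - N - K := by exact_mod_cast lower
    have upper' : M - N - K < 1 := by exact_mod_cast upper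
    omega
  have same_turn_real : (M - N - K : ℝ) = 0 := by exact_mod_cast same_turn
  rcases hK with hK | hK <;> linarith

/-- Two directions that form an angle close to a right one. -/
def NearRight (u v : ℂ) : Prop := |angle u v - π / 2| ≤ 1 / 10

theorem NearRight.symm {u v : ℂ} (h : NearRight u v) : NearRight v u := by
  rwa [NearRight, angle_comm]

/-- Two directions that are close to opposite. -/
def NearStraight (u v : ℂ) : Prop := |angle u v - π| ≤ 1 / 10

theorem NearStraight.symm {u v : ℂ} (h : NearStraight u v) : NearStraight v u := by
  rwa [NearStraight, angle_comm]

/-- The graph on the direction classes that joins the classes of orthogonal directions; it is a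
five-cycle, since a right angle is between two and three times `π / 5`. -/
def orthogonalClasses : SimpleGraph (ZMod 5) := SimpleGraph.circulantGraph {2}

theorem orthogonalClasses_adj_iff {q q' : ZMod 5} :
    orthogonalClasses.Adj q q' ↔ q - q' = 2 ∨ q - q' = 3 := by
  simp only [orthogonalClasses, SimpleGraph.circulantGraph_adj, Set.mem_singleton_iff]
  revert q q'
  decide

theorem floor_sub_floor_eq_two_or_three {x y : ℝ} (hlt : 2 < x - y) (hgt : x - y < 3) :
    ⌊x⌋ - ⌊y⌋ = 2 ∨ ⌊x⌋ - ⌊y⌋ = 3 := by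
  have lower : ((1 : ℤ) : ℝ) < (⌊x⌋ - ⌊y⌋ : ℤ) := by
    push_cast
    linarith [Int.lt_floor_add_one x, Int.floor_le y]
  have upper : ((⌊x⌋ - ⌊y⌋ : ℤ) : ℝ) < (4 : ℤ) := by
    push_cast
    linarith [Int.lt_floor_add_one y, Int.floor_le x]
  have lower' := Int.cast_lt.1 lower
  have upper' := Int.cast_lt.1 upper
  omega

theorem adj_sector_of_phase_sub_phase {u v : ℂ} {N : ℤ} (hlt : 2 < phase u - phase v + 10 * N)
    (hgt : phase u - phase v + 10 * N < 3) (t : ℝ) :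
    orthogonalClasses.Adj (sector t u) (sector t v) := by
  have floor_add : ⌊phase u - t + 10 * N⌋ = ⌊phase u - t⌋ + 10 * N := by
    exact_mod_cast Int.floor_add_intCast (phase u - t) (10 * N)
  have hfloor := floor_sub_floor_eq_two_or_three (x := phase u - t + 10 * N) (y := phase v - t)
    (by linarith) (by linarith)
  have ten_eq_zero : (10 : ZMod 5) = 0 := rfl
  rw [floor_add] at hfloor
  rw [orthogonalClasses_adj_iff, sector, sector]
  refine hfloor.imp (fun h => ?_) fun h => ?_ <;>
    · have := congrArg (Int.cast : ℤ → ZMod 5) h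
      push_cast [ten_eq_zero] at this
      linear_combination this

theorem adj_sector_of_nearRight {u v : ℂ} (hu : u ≠ 0) (hv : v ≠ 0) (huv : NearRight u v) (t : ℝ) :
    orthogonalClasses.Adj (sector t u) (sector t v) := by
  obtain ⟨N, hN⟩ := exists_phase_sub_phase_eq hu hv
  obtain ⟨hlo, hhi⟩ := abs_le.1 huv
  have two_lt : 2 < angle u v / (π / 5) := by
    rw [lt_div_iff₀ (by positivity)]
    linarith [Real.pi_gt_three]
  have lt_three : angle u v / (π / 5) < 3 := by
    rw [div_lt_iff₀ (by positivity)]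
    linarith [Real.pi_gt_three]
  rcases hN with hN | hN
  · exact adj_sector_of_phase_sub_phase (N := -N) (by push_cast; linarith)
      (by push_cast; linarith) t
  · exact (adj_sector_of_phase_sub_phase (N := N) (by linarith) (by linarith) t).symm

theorem exists_floor_sub_eq_sector {u v : ℂ} (hu : u ≠ 0) (hv : v ≠ 0) :
    ∃ y : ℝ, |y - phase u| = |angle u v - π| / (π / 5) ∧ ∀ t, sector t v = (⌊y - t⌋ : ℤ) := by
  have sector_eq (K : ℤ) (t : ℝ) : sector t v = (⌊phase v + 5 * K - t⌋ : ℤ) := by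
    have floor_add : ⌊phase v - t + 5 * K⌋ = ⌊phase v - t⌋ + 5 * K := by
      exact_mod_cast Int.floor_add_intCast (phase v - t) (5 * K)
    have five_eq_zero : (5 : ZMod 5) = 0 := rfl
    rw [add_sub_right_comm, floor_add, sector]
    push_cast [five_eq_zero]
    ring
  have defect_eq : |angle u v - π| / (π / 5) = |angle u v / (π / 5) - 5| := by
    have sub_five : angle u v / (π / 5) - 5 = (angle u v - π) / (π / 5) := by field
    rw [sub_five, abs_div, abs_of_pos (show 0 < π / 5 by positivity)]
  rw [defect_eq]
  obtain ⟨N, hN | hN⟩ := exists_phase_sub_phase_eq hu hv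
  · refine ⟨_, ?_, sector_eq (2 * N + 1)⟩
    rw [abs_sub_comm, sub_eq_iff_eq_add.1 hN]
    push_cast
    ring_nf
  · refine ⟨_, ?_, sector_eq (2 * N - 1)⟩
    rw [sub_eq_iff_eq_add.1 hN]
    push_cast
    ring_nf

theorem cliqueFree_three_orthogonalClasses : orthogonalClasses.CliqueFree 3 := by
  have : ∀ s : Finset (ZMod 5), ¬ orthogonalClasses.IsNClique 3 s := by
    simp only [SimpleGraph.isNClique_iff, SimpleGraph.IsClique, Set.Pairwise,
      orthogonalClasses_adj_iff]
    decide
  exact this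

theorem exists_adj_of_isClique_orthogonalClasses {s : Finset (ZMod 5)}
    (hs : orthogonalClasses.IsClique s) :
    ∃ a b, orthogonalClasses.Adj a b ∧ ∀ q ∈ s, q = a ∨ q = b := by
  simp only [SimpleGraph.IsClique, Set.Pairwise, orthogonalClasses_adj_iff] at hs ⊢
  revert s
  decide

end Sectors

section NearlySquare

open InnerProductGeometry
open scoped Real

/-- The drawing `p` of the graph `G` is nearly square if adjacent vertices are different points and
two bonds at the same vertex always have nearly orthogonal or nearly opposite directions. -/
structure IsNearlySquare {V : Type*} (G : SimpleGraph V) (p : V → ℂ) : Prop where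
  ne : ∀ {i j}, G.Adj i j → p i ≠ p j
  nearRight_or_nearStraight : ∀ {i j k}, G.Adj i j → G.Adj i k → j ≠ k →
    NearRight (p j - p i) (p k - p i) ∨ NearStraight (p j - p i) (p k - p i)

/-- How far an angle is from a straight one, counted only for nearly straight angles. -/
noncomputable def straightDefect (θ : ℝ) : ℝ := if |θ - π| ≤ 1 / 10 then |θ - π| else 0

theorem straightDefect_nonneg (θ : ℝ) : 0 ≤ straightDefect θ := by
  unfold straightDefect
  split_ifs <;> positivity

theorem straightDefect_of_nearStraight {u v : ℂ} (h : NearStraight u v) :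
    straightDefect (angle u v) = |angle u v - π| :=
  if_pos h

open Classical in
/-- The straightness defect of the angle between the bonds from `i` to `j` and to `k`, which is zero
if these are not two different bonds. -/
noncomputable def bondDefect {V : Type*} (G : SimpleGraph V) (p : V → ℂ) (i j k : V) : ℝ :=
  if j ≠ k ∧ G.Adj i j ∧ G.Adj i k then straightDefect (angle (p j - p i) (p k - p i)) else 0

theorem bondDefect_nonneg {V : Type*} (G : SimpleGraph V) (p : V → ℂ) (i j k : V) :
    0 ≤ bondDefect G p i j k := by
  unfold bondDefect
  split_ifs
  exacts [straightDefect_nonneg _, le_rfl]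

open Classical in
theorem bondDefect_comm {V : Type*} (G : SimpleGraph V) (p : V → ℂ) (i j k : V) :
    bondDefect G p i j k = bondDefect G p i k j := by
  rw [bondDefect, bondDefect, angle_comm]
  exact if_congr (by rw [ne_comm, and_comm (a := G.Adj i j)]) rfl rfl

theorem two_mul_sum_apply_le_sum_sum {V : Type*} [Fintype V] {f : V → V → ℝ}
    (f_nonneg : ∀ j k, 0 ≤ f j k) (f_symm : ∀ j k, f j k = f k j) {S T : Finset V}
    (hST : Disjoint S T) {r : V → V} (hr : ∀ l ∈ T, r l ∈ S) :
    2 * ∑ l ∈ T, f l (r l) ≤ ∑ j, ∑ k, f j k := by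
  classical
  have sum_le (j : V) (U : Finset V) : ∑ k ∈ U, f j k ≤ ∑ k, f j k :=
    sum_le_univ_sum_of_nonneg (f_nonneg j)
  have cross_symm : ∑ j ∈ T, ∑ k ∈ S, f j k = ∑ j ∈ S, ∑ k ∈ T, f j k := by
    rw [sum_comm]
    simp only [f_symm]
  calc 2 * ∑ l ∈ T, f l (r l) ≤ 2 * ∑ l ∈ T, ∑ k ∈ S, f l k := by
        gcongr with l hl
        exact single_le_sum (fun k _ => f_nonneg l k) (hr l hl)
    _ = ∑ j ∈ S, ∑ k ∈ T, f j k + ∑ j ∈ T, ∑ k ∈ S, f j k := by rw [cross_symm, two_mul]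
    _ ≤ ∑ j ∈ S, ∑ k, f j k + ∑ j ∈ T, ∑ k, f j k :=
        add_le_add (sum_le_sum fun j _ => sum_le j T) (sum_le_sum fun j _ => sum_le j S)
    _ = ∑ j ∈ S ∪ T, ∑ k, f j k := (sum_union hST).symm
    _ ≤ ∑ j, ∑ k, f j k := sum_le_univ_sum_of_nonneg fun j => sum_nonneg fun k _ => f_nonneg j k

namespace IsNearlySquare

variable {V : Type*} {G : SimpleGraph V} {p : V → ℂ}

theorem sub_ne_zero (h : IsNearlySquare G p) {i j : V} (hij : G.Adj i j) : p j - p i ≠ 0 :=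
  _root_.sub_ne_zero.2 (h.ne hij).symm

theorem eq_of_angle_lt (h : IsNearlySquare G p) {i j k : V} (hij : G.Adj i j) (hik : G.Adj i k)
    (hangle : angle (p j - p i) (p k - p i) < π / 5) : j = k := by
  by_contra hjk
  rcases h.nearRight_or_nearStraight hij hik hjk with hgood | hgood <;>
    linarith [(abs_le.1 hgood).1, Real.pi_gt_three]

/-- The class `q` of `sector t` becomes a strict order on the vertices. -/
def DirectionOrder (p : V → ℂ) (t : ℝ) (q : ZMod 5) (i j : V) : Prop :=
  InCone (t + q.val) (p j - p i)

theorem directionOrder_or_directionOrder_iff {i j : V} (h : p i ≠ p j) {t : ℝ} {q : ZMod 5} :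
    DirectionOrder p t q i j ∨ DirectionOrder p t q j i ↔ sector t (p j - p i) = q := by
  rw [← inCone_or_inCone_neg_iff (_root_.sub_ne_zero.2 h.symm), neg_sub, DirectionOrder,
    DirectionOrder]

theorem directionClasses (h : IsNearlySquare G p) (t : ℝ) :
    DirectionClasses G (DirectionOrder p t) where
  trans hij hjk := by simpa [DirectionOrder] using hij.add hjk
  irrefl hii := hii.ne_zero (sub_self _)
  unique {q q' i j} hq hq' := by
    have hne : p i ≠ p j := by
      rcases hq with hq | hq
      · exact (_root_.sub_ne_zero.1 hq.ne_zero).symm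
      · exact _root_.sub_ne_zero.1 hq.ne_zero
    rw [directionOrder_or_directionOrder_iff hne] at hq hq'
    exact hq.symm.trans hq'
  exists_class hij := ⟨_, (directionOrder_or_directionOrder_iff (h.ne hij)).2 rfl⟩
  out_unique hij hik hj hk := h.eq_of_angle_lt hij hik (angle_lt_of_inCone hj hk)
  in_unique {q i j k} hij hik hj hk := h.eq_of_angle_lt hij hik <| by
    rw [← angle_neg_neg, neg_sub, neg_sub]
    exact angle_lt_of_inCone hj hk

theorem exists_reference_bonds [Finite V] (h : IsNearlySquare G p) (i : V) :
    ∃ S : Finset V, (∀ j ∈ S, G.Adj i j) ∧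
      (∀ j ∈ S, ∀ k ∈ S, j ≠ k → NearRight (p j - p i) (p k - p i)) ∧
      ∀ l, G.Adj i l → l ∉ S → ∃ r ∈ S, NearStraight (p l - p i) (p r - p i) := by
  classical
  let orthogonal (S : Finset V) : Prop := (∀ j ∈ S, G.Adj i j) ∧
    ∀ j ∈ S, ∀ k ∈ S, j ≠ k → NearRight (p j - p i) (p k - p i)
  obtain ⟨S, ⟨hadj, horth⟩, hmax⟩ := ({S | orthogonal S} : Set (Finset V)).toFinite.exists_maximal
    ⟨∅, by simp [orthogonal]⟩
  refine ⟨S, hadj, horth, fun l hl hlS => ?_⟩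
  by_contra! hnot
  have near_right (r : V) (hr : r ∈ S) : NearRight (p l - p i) (p r - p i) :=
    (h.nearRight_or_nearStraight hl (hadj r hr) (by grind)).resolve_right (hnot r hr)
  have insert_orthogonal : orthogonal (insert l S) := by
    refine ⟨by grind, fun j hj k hk hjk => ?_⟩
    rcases mem_insert.1 hj with rfl | hjS <;> rcases mem_insert.1 hk with rfl | hkS
    · exact absurd rfl hjk
    · exact near_right k hkS
    · exact (near_right j hjS).symm
    · exact horth j hjS k hkS hjk
  exact hlS (hmax insert_orthogonal (subset_insert l S) (mem_insert_self l S))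

/-- A choice of reference bonds: at each vertex `i` a set `S i` of neighbours in nearly orthogonal
directions, and for each remaining neighbour `l` one of them, `r i l`, nearly opposite to it. -/
structure IsReference {V : Type*} (G : SimpleGraph V) (p : V → ℂ) (S : V → Finset V)
    (r : V → V → V) : Prop where
  adj : ∀ {i j}, j ∈ S i → G.Adj i j
  nearRight : ∀ {i j k}, j ∈ S i → k ∈ S i → j ≠ k → NearRight (p j - p i) (p k - p i)
  mem : ∀ {i l}, G.Adj i l → l ∉ S i → r i l ∈ S i
  nearStraight : ∀ {i l}, G.Adj i l → l ∉ S i → NearStraight (p l - p i) (p (r i l) - p i)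

theorem exists_isReference [Finite V] (h : IsNearlySquare G p) : ∃ S r, IsReference G p S r := by
  choose S hadj horth hex using h.exists_reference_bonds
  choose! r hr using hex
  exact ⟨S, r, hadj _ _, fun hj hk => horth _ _ hj _ hk, fun hl hlS => (hr _ _ hl hlS).1,
    fun hl hlS => (hr _ _ hl hlS).2⟩

/-- The bonds from `i` to `l` outside the reference set `S i` whose class differs from that of the
nearly opposite reference bond, the classes being counted from the phase `t`. -/
def Misclassified (G : SimpleGraph V) (p : V → ℂ) (S : V → Finset V) (r : V → V → V) (t : ℝ)
    (x : V × V) : Prop :=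
  (G.Adj x.1 x.2 ∧ x.2 ∉ S x.1) ∧
    sector t (p x.2 - p x.1) ≠ sector t (p (r x.1 x.2) - p x.1)

theorem IsReference.two_mul_sum_le_sum_bondDefect [Fintype V] {S : V → Finset V} {r : V → V → V}
    (hS : IsReference G p S r) {A : Finset (V × V)} (hA : ∀ x ∈ A, G.Adj x.1 x.2 ∧ x.2 ∉ S x.1) :
    2 * ∑ x ∈ A, |angle (p x.2 - p x.1) (p (r x.1 x.2) - p x.1) - π| ≤
      ∑ i, ∑ j, ∑ k, bondDefect G p i j k := by
  classical
  have bondDefect_reference {x : V × V} (hx : x ∈ A) : bondDefect G p x.1 x.2 (r x.1 x.2) =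
      |angle (p x.2 - p x.1) (p (r x.1 x.2) - p x.1) - π| := by
    obtain ⟨hadj, hnot⟩ := hA x hx
    have hmem := hS.mem hadj hnot
    rw [bondDefect, if_pos ⟨fun heq => hnot (heq ▸ hmem), hadj, hS.adj hmem⟩,
      straightDefect_of_nearStraight (hS.nearStraight hadj hnot)]
  calc 2 * ∑ x ∈ A, |angle (p x.2 - p x.1) (p (r x.1 x.2) - p x.1) - π|
      = ∑ i, 2 * ∑ l with (i, l) ∈ A, bondDefect G p i l (r i l) := by
        rw [← mul_sum, ← sum_congr rfl fun x hx => bondDefect_reference hx]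
        congr 1
        exact sum_finset_product A univ _ (by simp)
    _ ≤ ∑ i, ∑ j, ∑ k, bondDefect G p i j k := by
        gcongr with i
        refine two_mul_sum_apply_le_sum_sum (S := S i) (bondDefect_nonneg G p i)
          (bondDefect_comm G p i) ?_ fun l hl => ?_
        · exact disjoint_right.2 fun l hl => (hA _ ((mem_filter_univ l).1 hl)).2
        · obtain ⟨hadj, hnot⟩ := hA _ ((mem_filter_univ l).1 hl)
          exact hS.mem hadj hnot

open Classical in
theorem exists_card_misclassified_le [Fintype V] (h : IsNearlySquare G p) {S : V → Finset V}
    {r : V → V → V} (hS : IsReference G p S r) :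
    ∃ t, (#{x | Misclassified G p S r t x} : ℝ) ≤
      1 / 2 * (5 / π * ∑ i, ∑ j, ∑ k, bondDefect G p i j k) := by
  let A : Finset (V × V) := {x | G.Adj x.1 x.2 ∧ x.2 ∉ S x.1}
  have hA (x) (hx : x ∈ A) : G.Adj x.1 x.2 ∧ x.2 ∉ S x.1 := by simpa [A] using hx
  have reference_floor (x : V × V) (hx : x ∈ A) := exists_floor_sub_eq_sector
    (h.sub_ne_zero (hA x hx).1) (h.sub_ne_zero (hS.adj (hS.mem (hA x hx).1 (hA x hx).2)))
  choose! y abs_sub_eq sector_eq using reference_floor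
  obtain ⟨t, ht⟩ := exists_card_floor_sub_ne_le A (fun x => phase (p x.2 - p x.1)) y
  refine ⟨t, ?_⟩
  calc (#{x | Misclassified G p S r t x} : ℝ)
      ≤ #{x ∈ A | ⌊y x - t⌋ ≠ ⌊phase (p x.2 - p x.1) - t⌋} := by
        gcongr
        intro x hx
        obtain ⟨hxA, hne⟩ := (mem_filter_univ x).1 hx
        refine mem_filter.2 ⟨(mem_filter_univ x).2 hxA, fun heq => hne ?_⟩
        rw [sector_eq x ((mem_filter_univ x).2 hxA), heq, sector]
    _ ≤ ∑ x ∈ A, |y x - phase (p x.2 - p x.1)| := ht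
    _ = 1 / 2 * (5 / π * (2 * ∑ x ∈ A, |angle (p x.2 - p x.1) (p (r x.1 x.2) - p x.1) - π|)) := by
        rw [sum_congr rfl abs_sub_eq, ← sum_div]
        field
    _ ≤ 1 / 2 * (5 / π * ∑ i, ∑ j, ∑ k, bondDefect G p i j k) := by
        gcongr
        exact hS.two_mul_sum_le_sum_bondDefect hA

open Classical in
theorem card_stray_le_card_misclassified [Fintype V] (h : IsNearlySquare G p) {S : V → Finset V}
    {r : V → V → V} (hS : IsReference G p S r) {t : ℝ} {a b : V → ZMod 5}
    (hab : ∀ {i j}, j ∈ S i → sector t (p j - p i) = a i ∨ sector t (p j - p i) = b i) :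
    #{x : V × ZMod 5 | DirectionClasses.Stray G (DirectionOrder p t) a b x.2 x.1} ≤
      #{x | Misclassified G p S r t x} := by
  refine card_le_card_of_surjOn (fun x => (x.1, sector t (p x.2 - p x.1))) ?_
  rintro ⟨i, q⟩ hx
  have stray : DirectionClasses.Stray G (DirectionOrder p t) a b q i := by
    simpa using hx
  obtain ⟨⟨l, hil, hl⟩, hq⟩ := stray
  obtain rfl := (directionOrder_or_directionOrder_iff (h.ne hil)).1 hl
  have hlS : l ∉ S i := fun hlS => hq (hab hlS)
  refine ⟨(i, l), mem_coe.2 ((mem_filter_univ _).2 ⟨⟨hil, hlS⟩, fun heq => hq ?_⟩), rfl⟩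
  change sector t (p l - p i) = sector t _ at heq
  exact heq ▸ hab (hS.mem hil hlS)

theorem exists_axes (h : IsNearlySquare G p) {S : V → Finset V} {r : V → V → V}
    (hS : IsReference G p S r) (t : ℝ) :
    ∃ a b : V → ZMod 5, (∀ i, orthogonalClasses.Adj (a i) (b i)) ∧
      ∀ {i j}, j ∈ S i → sector t (p j - p i) = a i ∨ sector t (p j - p i) = b i := by
  have isClique_classes (i : V) :
      orthogonalClasses.IsClique ((S i).image fun j => sector t (p j - p i)) := by
    simp only [coe_image]
    rintro _ ⟨j, hj, rfl⟩ _ ⟨k, hk, rfl⟩ hne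
    exact adj_sector_of_nearRight (h.sub_ne_zero (hS.adj hj)) (h.sub_ne_zero (hS.adj hk))
      (hS.nearRight hj hk fun hjk => hne (by rw [hjk])) t
  choose a b hadj hmem using fun i => exists_adj_of_isClique_orthogonalClasses (isClique_classes i)
  exact ⟨a, b, hadj, fun hj => hmem _ _ (mem_image_of_mem _ hj)⟩

open Classical in
theorem ceil_add_card_edgeFinset_le [Fintype V] (h : IsNearlySquare G p) :
    (⌈2 * √(Fintype.card V)⌉ + #G.edgeFinset : ℝ) ≤
      2 * Fintype.card V + 1 / 2 * (5 / π * ∑ i, ∑ j, ∑ k, bondDefect G p i j k) := by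
  obtain ⟨S, r, hS⟩ := h.exists_isReference
  obtain ⟨t, ht⟩ := h.exists_card_misclassified_le hS
  obtain ⟨a, b, hadj, hab⟩ := h.exists_axes hS t
  obtain ⟨P, hP, hcard⟩ := (h.directionClasses t).exists_four_mul_card_le_sq
    cliqueFree_three_orthogonalClasses hadj
  have ceil_le : (⌈2 * √(Fintype.card V)⌉ : ℝ) ≤ P := by
    have : 2 * √(Fintype.card V) ≤ P := by
      refine le_of_sq_le_sq ?_ P.cast_nonneg
      rw [mul_pow, Real.sq_sqrt (Nat.cast_nonneg _)]
      exact_mod_cast hP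
    exact_mod_cast Int.ceil_le.2 (by exact_mod_cast this)
  have card_le := hcard.trans
    (Nat.add_le_add_left (h.card_stray_le_card_misclassified hS hab) _)
  have card_le_real : (P + #G.edgeFinset : ℝ) ≤
      2 * Fintype.card V + #{x | Misclassified G p S r t x} := mod_cast card_le
  linarith

end IsNearlySquare

end NearlySquare

section Potentials

open InnerProductGeometry
open scoped Real

/-- A two-body potential that is at least `-1`, with equality at most at distance `1`, vanishes
beyond `r₀ < 3 / 2` and is so large up to distance `3 / 4` that close particles are unfavourable. -/
structure IsHardCorePotential (r₀ : ℝ) (v : ℝ → EReal) : Prop where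
  range_lt : r₀ < 3 / 2
  neg_one_le : ∀ {r}, 0 ≤ r → ((-1 : ℝ) : EReal) ≤ v r
  eq_one : ∀ {r}, 0 ≤ r → v r = ((-1 : ℝ) : EReal) → r = 1
  eq_zero : ∀ {r}, r₀ ≤ r → v r = 0
  repulsive : ∀ {r}, 0 ≤ r → r ≤ 3 / 4 → ((73 : ℝ) : EReal) < v r

/-- A three-body potential that is at least `5 / π` times the straightness defect, with equality
only at nonzero multiples of `π / 2`, and is large away from these. -/
structure IsRightAnglePotential (v₃ : ℝ → ℝ) : Prop where
  straightDefect_le : ∀ {θ}, θ ∈ Set.Icc 0 (2 * π) → 5 / π * straightDefect θ ≤ v₃ θ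
  eq_right_angle : ∀ {θ}, θ ∈ Set.Icc 0 (2 * π) → v₃ θ = 5 / π * straightDefect θ →
    θ = π / 2 ∨ θ = π ∨ θ = 3 * π / 2
  twelve_le : ∀ {θ}, θ ∈ Set.Icc 0 (2 * π) → 1 / 10 < |θ - π / 2| → 1 / 10 < |θ - π| →
    1 / 10 < |θ - 3 * π / 2| → 12 ≤ v₃ θ

/-- A real-valued minorant of the two-body potential `v` that is large wherever `v` is. -/
noncomputable def truncate (v : ℝ → EReal) (r : ℝ) : ℝ := (min (v r) (74 : ℝ)).toReal

namespace IsHardCorePotential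

variable {r₀ : ℝ} {v : ℝ → EReal}

theorem coe_truncate (h : IsHardCorePotential r₀ v) {r : ℝ} (hr : 0 ≤ r) :
    (truncate v r : EReal) = min (v r) (74 : ℝ) := by
  refine EReal.coe_toReal (min_lt_of_right_lt (EReal.coe_lt_top 74)).ne (ne_of_gt ?_)
  exact lt_min ((EReal.bot_lt_coe (-1)).trans_le (h.neg_one_le hr)) (EReal.bot_lt_coe 74)

theorem coe_truncate_le (h : IsHardCorePotential r₀ v) {r : ℝ} (hr : 0 ≤ r) :
    (truncate v r : EReal) ≤ v r :=
  (h.coe_truncate hr).trans_le (min_le_left _ _)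

theorem isHardCorePotential_truncate (h : IsHardCorePotential r₀ v) :
    IsHardCorePotential r₀ fun r => truncate v r where
  range_lt := h.range_lt
  neg_one_le hr := by
    rw [h.coe_truncate hr]
    exact le_min (h.neg_one_le hr) (EReal.coe_le_coe (by norm_num))
  eq_one {r} hr heq := by
    rw [h.coe_truncate hr] at heq
    rcases min_choice (v r) (74 : ℝ) with hmin | hmin <;> rw [hmin] at heq
    · exact h.eq_one hr heq
    · exact absurd (EReal.coe_injective heq) (by norm_num)
  eq_zero hr := by
    rw [truncate, h.eq_zero hr, min_eq_left (EReal.coe_nonneg.2 (by norm_num)), EReal.toReal_zero,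
      EReal.coe_zero]
  repulsive hr hr' := by
    rw [h.coe_truncate hr]
    exact lt_min (h.repulsive hr hr') (EReal.coe_lt_coe (by norm_num))

end IsHardCorePotential

theorem IsTwoBodyPotential.isHardCorePotential {ε r₀ : ℝ} {v₂ : ℝ → EReal}
    (h : IsTwoBodyPotential ε r₀ v₂) (hε : 0 < ε) (hε' : ε < 1 / 100) :
    IsHardCorePotential r₀ v₂ where
  range_lt := h.range_lt_sqrt_two.trans ((Real.sqrt_lt' (by norm_num)).2 (by norm_num))
  neg_one_le {r} hr := by
    rcases eq_or_ne r 1 with rfl | hne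
    exacts [h.min_eq.ge, (h.min_unique r hr hne).le]
  eq_one {r} hr heq := by
    by_contra hne
    exact (h.min_unique r hr hne).ne' heq
  eq_zero hr := h.eq_zero _ hr
  repulsive hr hr' := by
    have lt_inv : 73 < ε⁻¹ := by
      rw [lt_inv_comm₀ (by norm_num) hε]
      linarith
    exact (EReal.coe_lt_coe lt_inv).trans (h.repulsive _ hr (by linarith))

namespace IsThreeBodyPotential

variable {ε : ℝ} {v₃ : ℝ → ℝ} {θ : ℝ}

theorem nonneg (h : IsThreeBodyPotential ε v₃) (hθ : θ ∈ Set.Icc 0 (2 * π)) : 0 ≤ v₃ θ := by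
  by_cases hgood : θ = π / 2 ∨ θ = π ∨ θ = 3 * π / 2
  · rcases hgood with rfl | rfl | rfl
    exacts [h.zero_half_pi.ge, h.zero_pi.ge, h.zero_three_half_pi.ge]
  · push Not at hgood
    exact (h.pos θ hθ hgood.1 hgood.2.1 hgood.2.2).le

theorem twelve_lt_of_abs (h : IsThreeBodyPotential ε v₃) (hε : 0 < ε) (hε' : ε < 1 / 100)
    (hθ : θ ∈ Set.Icc 0 (2 * π)) (hright : ε < |θ - π / 2|) (hstraight : ε < |θ - π|)
    (hright' : ε < |θ - 3 * π / 2|) : 12 < v₃ θ := by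
  have constant_large : (12 : ℝ) ≤ 4 / (1 - ε) ^ 2 * (√2 + 1 / 2) ^ 2 := by
    have le_sqrt : 7 / 5 ≤ √2 := Real.le_sqrt_of_sq_le (by norm_num)
    calc (12 : ℝ) ≤ 4 / 1 * (7 / 5 + 1 / 2) ^ 2 := by norm_num
      _ ≤ 4 / (1 - ε) ^ 2 * (√2 + 1 / 2) ^ 2 := by
        gcongr
        · nlinarith
        · nlinarith
  refine constant_large.trans_lt (h.large θ hθ ?_)
  simp only [← Real.closedBall_eq_Icc, Set.mem_union, Metric.mem_closedBall, Real.dist_eq, not_or,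
    not_le]
  exact ⟨⟨hright, hstraight⟩, hright'⟩

theorem mul_abs_lt (h : IsThreeBodyPotential ε v₃) (hε : 0 < ε) (hε' : ε < 1 / 100)
    (hθ : |θ - π| ≤ 1 / 10) (hne : θ ≠ π) : 5 / π * |θ - π| < v₃ θ := by
  have hpi := Real.pi_gt_three
  have hpos : 0 < |θ - π| := abs_pos.2 (sub_ne_zero.2 hne)
  have hbounds := abs_le.1 hθ
  rcases le_or_gt |θ - π| ε with hnear | hfar
  · have slope_lt : 5 / π < 4 * (π / 6 - ε)⁻¹ := by
      rw [← div_eq_mul_inv, div_lt_div_iff₀ Real.pi_pos (by linarith)]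
      linarith
    refine (mul_lt_mul_of_pos_right slope_lt hpos).trans_le (h.slope θ ?_)
    rw [← Real.closedBall_eq_Icc]
    exact hnear
  · have hlarge : 12 < v₃ θ := h.twelve_lt_of_abs hε hε' ⟨by linarith, by linarith⟩
      (lt_abs.2 (.inl (by linarith))) hfar (lt_abs.2 (.inr (by linarith)))
    refine lt_trans ?_ hlarge
    have : 5 / π < 5 / 3 := by gcongr
    nlinarith

theorem straightDefect_lt (h : IsThreeBodyPotential ε v₃) (hε : 0 < ε) (hε' : ε < 1 / 100)
    (hθ : θ ∈ Set.Icc 0 (2 * π)) (hbad : ¬(θ = π / 2 ∨ θ = π ∨ θ = 3 * π / 2)) :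
    5 / π * straightDefect θ < v₃ θ := by
  push Not at hbad
  unfold straightDefect
  split_ifs with hnear
  · exact h.mul_abs_lt hε hε' hnear hbad.2.1
  · rw [mul_zero]
    exact h.pos θ hθ hbad.1 hbad.2.1 hbad.2.2

theorem isRightAnglePotential (h : IsThreeBodyPotential ε v₃) (hε : 0 < ε) (hε' : ε < 1 / 100) :
    IsRightAnglePotential v₃ where
  straightDefect_le {θ} hθ := by
    rcases eq_or_ne θ π with rfl | hne
    · simp [straightDefect, h.zero_pi]
    · unfold straightDefect
      split_ifs with hnear
      · exact (h.mul_abs_lt hε hε' hnear hne).le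
      · simpa using h.nonneg hθ
  eq_right_angle hθ heq := by
    by_contra hbad
    exact (h.straightDefect_lt hε hε' hθ hbad).ne' heq
  twelve_le hθ hright hstraight hright' :=
    (h.twelve_lt_of_abs hε hε' hθ (by linarith) (by linarith) (by linarith)).le

end IsThreeBodyPotential

end Potentials

section PlaneAngles

open InnerProductGeometry
open scoped Real

theorem toComplex_sub (x y : Plane) : toComplex (x - y) = toComplex x - toComplex y := by
  apply Complex.ext <;> simp [toComplex]

theorem norm_toComplex (x : Plane) : ‖toComplex x‖ = ‖x‖ := by
  rw [EuclideanSpace.norm_eq, Complex.norm_def, Complex.normSq_apply]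
  simp [toComplex, Fin.sum_univ_two, sq]

theorem dist_eq_norm_toComplex_sub (x y : Plane) : dist x y = ‖toComplex x - toComplex y‖ := by
  rw [← toComplex_sub, norm_toComplex, dist_eq_norm]

theorem toComplex_injective : Function.Injective toComplex := by
  intro x y h
  rw [← dist_eq_zero, dist_eq_norm_toComplex_sub, h, sub_self, norm_zero]

theorem clockwiseAngle_mem_Icc (x y z : Plane) : clockwiseAngle x y z ∈ Set.Icc 0 (2 * π) := by
  rw [← zero_add (2 * π)]
  exact Set.Ico_subset_Icc_self (toIcoMod_mem_Ico Real.two_pi_pos 0 _)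

variable {x y z : Plane}

theorem exp_clockwiseAngle_mul_I (hz : z ≠ y) (hdist : dist x y = dist z y) :
    Complex.exp (clockwiseAngle x y z * Complex.I) =
      (toComplex x - toComplex y) / (toComplex z - toComplex y) := by
  have norm_eq_one : ‖(toComplex x - toComplex y) / (toComplex z - toComplex y)‖ = 1 := by
    rw [norm_div, ← dist_eq_norm_toComplex_sub, ← dist_eq_norm_toComplex_sub, hdist,
      div_self (dist_ne_zero.2 hz)]
  have exp_arg := Complex.norm_mul_exp_arg_mul_I
    ((toComplex x - toComplex y) / (toComplex z - toComplex y))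
  rw [norm_eq_one, Complex.ofReal_one, one_mul] at exp_arg
  rw [clockwiseAngle, ← self_sub_toIcoDiv_zsmul, toComplex_sub, toComplex_sub]
  push_cast
  exact (Complex.exp_mul_I_periodic.sub_zsmul_eq _).trans exp_arg

theorem angle_toComplex_sub (hx : x ≠ y) (hz : z ≠ y) :
    angle (toComplex x - toComplex y) (toComplex z - toComplex y) =
      π - |clockwiseAngle x y z - π| := by
  have hu := sub_ne_zero.2 (toComplex_injective.ne hx)
  have hv := sub_ne_zero.2 (toComplex_injective.ne hz)
  rw [Complex.angle_eq_abs_arg hu hv, clockwiseAngle, toComplex_sub, toComplex_sub]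
  set α := Complex.arg ((toComplex x - toComplex y) / (toComplex z - toComplex y))
  have hα : α ∈ Set.Ioc (-π) π := Complex.arg_mem_Ioc _
  rcases le_or_gt 0 α with hpos | hneg
  · rw [(toIcoMod_eq_self Real.two_pi_pos).2 ⟨hpos, by linarith [hα.2, Real.pi_pos]⟩,
      abs_of_nonneg hpos, abs_of_nonpos (by linarith [hα.2])]
    ring
  · rw [← toIcoMod_add_right,
      (toIcoMod_eq_self Real.two_pi_pos).2 ⟨by linarith [hα.1], by linarith⟩, abs_of_neg hneg,
      abs_of_nonneg (by linarith [hα.1])]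
    ring

theorem abs_angle_toComplex_sub_sub_pi (hx : x ≠ y) (hz : z ≠ y) :
    |angle (toComplex x - toComplex y) (toComplex z - toComplex y) - π| =
      |clockwiseAngle x y z - π| := by
  rw [angle_toComplex_sub hx hz, sub_sub_cancel_left, abs_neg, abs_abs]

theorem IsRightAnglePotential.straightDefect_angle_le {v₃ : ℝ → ℝ} (h : IsRightAnglePotential v₃)
    (hx : x ≠ y) (hz : z ≠ y) :
    5 / π * straightDefect (angle (toComplex x - toComplex y) (toComplex z - toComplex y)) ≤
      v₃ (clockwiseAngle x y z) := by
  simpa only [straightDefect, abs_angle_toComplex_sub_sub_pi hx hz] using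
    h.straightDefect_le (clockwiseAngle_mem_Icc x y z)

theorem IsRightAnglePotential.clockwiseAngle_eq {v₃ : ℝ → ℝ} (h : IsRightAnglePotential v₃)
    (hx : x ≠ y) (hz : z ≠ y) (heq : v₃ (clockwiseAngle x y z) =
      5 / π * straightDefect (angle (toComplex x - toComplex y) (toComplex z - toComplex y))) :
    clockwiseAngle x y z = π / 2 ∨ clockwiseAngle x y z = π ∨ clockwiseAngle x y z = 3 * π / 2 :=
  h.eq_right_angle (clockwiseAngle_mem_Icc x y z) <| by
    simpa only [straightDefect, abs_angle_toComplex_sub_sub_pi hx hz] using heq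

theorem IsRightAnglePotential.twelve_le_of_not_near {v₃ : ℝ → ℝ} (h : IsRightAnglePotential v₃)
    (hx : x ≠ y) (hz : z ≠ y)
    (hbad : ¬(NearRight (toComplex x - toComplex y) (toComplex z - toComplex y) ∨
      NearStraight (toComplex x - toComplex y) (toComplex z - toComplex y))) :
    12 ≤ v₃ (clockwiseAngle x y z) := by
  rw [NearRight, NearStraight, abs_angle_toComplex_sub_sub_pi hx hz, angle_toComplex_sub hx hz]
    at hbad
  push Not at hbad
  obtain ⟨hright, hstraight⟩ := hbad
  have hle := Real.pi_gt_three
  refine h.twelve_le (clockwiseAngle_mem_Icc x y z) ?_ hstraight ?_ <;> contrapose! hright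
  · rw [abs_of_nonpos (a := clockwiseAngle x y z - π) (by linarith [(abs_le.1 hright).2])]
    convert hright using 2
    ring
  · rw [abs_of_nonneg (a := clockwiseAngle x y z - π) (by linarith [(abs_le.1 hright).1]),
      ← abs_neg]
    convert hright using 2
    ring

end PlaneAngles

section Energy

variable {ι : Type*} {r₀ : ℝ} {w v₃ : ℝ → ℝ}

/-- The graph whose edges are the bonds of a configuration. -/
def bondGraph (r₀ : ℝ) (C : ι → Plane) : SimpleGraph ι where
  Adj i j := IsBond r₀ (C i) (C j)
  symm := ⟨fun _ _ h => ⟨h.1.symm, (dist_comm _ _).trans_le h.2⟩⟩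
  loopless := ⟨fun _ h => h.1 rfl⟩

open Classical in
/-- The two-body term of an ordered pair of particles. -/
noncomputable def pairTerm (w : ℝ → ℝ) (C : ι → Plane) (i j : ι) : ℝ :=
  if i ≠ j then w (dist (C i) (C j)) else 0

open Classical in
/-- The three-body term of an ordered triple of particles. -/
noncomputable def tripleTerm (v₃ : ℝ → ℝ) (r₀ : ℝ) (C : ι → Plane) (i j k : ι) : ℝ :=
  if j ≠ k ∧ (bondGraph r₀ C).Adj i j ∧ (bondGraph r₀ C).Adj i k then
    v₃ (clockwiseAngle (C j) (C i) (C k))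
  else 0

/-- The energy of a configuration for a real-valued two-body potential `w`, with particles indexed
by an arbitrary finite type so that it applies to subconfigurations. -/
noncomputable def realEnergy [Fintype ι] (w v₃ : ℝ → ℝ) (r₀ : ℝ) (C : ι → Plane) : ℝ :=
  1 / 2 * ∑ i, ∑ j, pairTerm w C i j + 1 / 2 * ∑ i, ∑ j, ∑ k, tripleTerm v₃ r₀ C i j k

/-- The two-body energy within `S` together with the three-body energy of all angles whose vertex
is in `S`. -/
noncomputable def localEnergy [Fintype ι] (w v₃ : ℝ → ℝ) (r₀ : ℝ) (C : ι → Plane)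
    (S : Finset ι) : ℝ :=
  1 / 2 * ∑ i ∈ S, ∑ j ∈ S, pairTerm w C i j + 1 / 2 * ∑ i ∈ S, ∑ j, ∑ k, tripleTerm v₃ r₀ C i j k

/-- The interactions of the particle `i` with the others: its two-body terms and the three-body
terms of the angles at it. -/
noncomputable def removalEnergy [Fintype ι] (w v₃ : ℝ → ℝ) (r₀ : ℝ) (C : ι → Plane) (i : ι) : ℝ :=
  ∑ j, pairTerm w C i j + 1 / 2 * ∑ j, ∑ k, tripleTerm v₃ r₀ C i j k

theorem pairTerm_self (w : ℝ → ℝ) (C : ι → Plane) (i : ι) : pairTerm w C i i = 0 :=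
  if_neg (not_not.2 rfl)

open Classical in
theorem pairTerm_comm (w : ℝ → ℝ) (C : ι → Plane) (i j : ι) :
    pairTerm w C i j = pairTerm w C j i := by
  rw [pairTerm, pairTerm, dist_comm]
  exact if_congr ne_comm rfl rfl

open Classical in
theorem pairTerm_comp {κ : Type*} {C : ι → Plane} {f : κ → ι} (hf : f.Injective) (i j : κ) :
    pairTerm w (C ∘ f) i j = pairTerm w C (f i) (f j) :=
  if_congr hf.ne_iff.symm rfl rfl

open Classical in
theorem tripleTerm_comp {κ : Type*} {C : ι → Plane} {f : κ → ι} (hf : f.Injective) (i j k : κ) :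
    tripleTerm v₃ r₀ (C ∘ f) i j k = tripleTerm v₃ r₀ C (f i) (f j) (f k) :=
  if_congr (and_congr_left' hf.ne_iff.symm) rfl rfl

theorem bondDefect_le_tripleTerm (h₃ : IsRightAnglePotential v₃) (C : ι → Plane) (i j k : ι) :
    5 / Real.pi * bondDefect (bondGraph r₀ C) (toComplex ∘ C) i j k ≤
      tripleTerm v₃ r₀ C i j k := by
  unfold bondDefect tripleTerm
  split_ifs with h
  · exact h₃.straightDefect_angle_le h.2.1.1.symm h.2.2.1.symm
  · rw [mul_zero]

theorem tripleTerm_nonneg (h₃ : IsRightAnglePotential v₃) (C : ι → Plane) (i j k : ι) :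
    0 ≤ tripleTerm v₃ r₀ C i j k :=
  (mul_nonneg (by positivity) (bondDefect_nonneg _ _ i j k)).trans
    (bondDefect_le_tripleTerm h₃ C i j k)

theorem sum_sum_coe_le {S : Finset ι} [Fintype ι] {f : ι → ι → ℝ} (hf : ∀ j k, 0 ≤ f j k) :
    ∑ j : S, ∑ k : S, f j k ≤ ∑ j, ∑ k, f j k := by
  calc ∑ j : S, ∑ k : S, f j k = ∑ j ∈ S, ∑ k ∈ S, f j k := by
        rw [← sum_coe_sort S]
        exact sum_congr rfl fun j _ => sum_coe_sort S (f j)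
    _ ≤ ∑ j ∈ S, ∑ k, f j k := sum_le_sum fun j _ => sum_le_univ_sum_of_nonneg (hf j)
    _ ≤ ∑ j, ∑ k, f j k := sum_le_univ_sum_of_nonneg fun j => sum_nonneg fun k _ => hf j k

variable [Fintype ι]

theorem realEnergy_coe_le_localEnergy (h₃ : IsRightAnglePotential v₃) (C : ι → Plane)
    (S : Finset ι) :
    realEnergy w v₃ r₀ (C ∘ ((↑) : S → ι)) ≤ localEnergy w v₃ r₀ C S := by
  have pairTerm_coe := pairTerm_comp (w := w) (C := C) (Subtype.val_injective (p := (· ∈ S)))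
  have tripleTerm_coe :=
    tripleTerm_comp (v₃ := v₃) (r₀ := r₀) (C := C) (Subtype.val_injective (p := (· ∈ S)))
  simp only [realEnergy, localEnergy, pairTerm_coe, tripleTerm_coe, ← sum_coe_sort S]
  gcongr with i
  exact sum_sum_coe_le (tripleTerm_nonneg h₃ C i)

theorem realEnergy_eq_localEnergy_add [DecidableEq ι] (C : ι → Plane) (S : Finset ι) :
    realEnergy w v₃ r₀ C = localEnergy w v₃ r₀ C S + localEnergy w v₃ r₀ C Sᶜ +
      ∑ i ∈ S, ∑ j ∈ Sᶜ, pairTerm w C i j := by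
  have cross_symm : ∑ i ∈ Sᶜ, ∑ j ∈ S, pairTerm w C i j = ∑ i ∈ S, ∑ j ∈ Sᶜ, pairTerm w C i j := by
    rw [sum_comm]
    simp only [pairTerm_comm]
  have pairs_split : ∑ i, ∑ j, pairTerm w C i j = ∑ i ∈ S, ∑ j ∈ S, pairTerm w C i j +
      ∑ i ∈ Sᶜ, ∑ j ∈ Sᶜ, pairTerm w C i j + 2 * ∑ i ∈ S, ∑ j ∈ Sᶜ, pairTerm w C i j := by
    simp only [← sum_add_sum_compl S, sum_add_distrib, cross_symm]
    ring
  rw [realEnergy, localEnergy, localEnergy, pairs_split,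
    ← sum_add_sum_compl S fun i => ∑ j, ∑ k, tripleTerm v₃ r₀ C i j k]
  ring

theorem realEnergy_compl_singleton_add_le [DecidableEq ι] (h₃ : IsRightAnglePotential v₃)
    (C : ι → Plane) (i : ι) :
    realEnergy w v₃ r₀ (C ∘ ((↑) : ({i}ᶜ : Finset ι) → ι)) + removalEnergy w v₃ r₀ C i ≤
      realEnergy w v₃ r₀ C := by
  have pairs_at : ∑ j ∈ {i}ᶜ, pairTerm w C i j = ∑ j, pairTerm w C i j := by
    rw [← sum_add_sum_compl {i}, sum_singleton, pairTerm_self, zero_add]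
  have := realEnergy_coe_le_localEnergy (w := w) (r₀ := r₀) h₃ C {i}ᶜ
  rw [realEnergy_eq_localEnergy_add C {i}, removalEnergy, localEnergy]
  simp only [sum_singleton, pairTerm_self, pairs_at]
  linarith

end Energy

section ClosePairs

variable {ι : Type*} [Fintype ι] {r₀ : ℝ} {w v₃ : ℝ → ℝ}

/-- The square of side `1 / 2` of a grid that contains a point of the plane. -/
noncomputable def cell (x : Plane) : ℤ × ℤ := (⌊2 * x 0⌋, ⌊2 * x 1⌋)

theorem dist_le_of_cell_eq {x y : Plane} (h : cell x = cell y) : dist x y ≤ 3 / 4 := by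
  have sq_le {s t : ℝ} (hst : ⌊2 * s⌋ = ⌊2 * t⌋) : (s - t) ^ 2 ≤ 1 / 4 := by
    have := abs_lt.1 (Int.abs_sub_lt_one_of_floor_eq_floor hst)
    nlinarith
  rw [EuclideanSpace.dist_eq, Fin.sum_univ_two, Real.dist_eq, Real.dist_eq, sq_abs, sq_abs]
  refine Real.sqrt_le_iff.2 ⟨by norm_num, ?_⟩
  linarith [sq_le (Prod.ext_iff.1 h).1, sq_le (Prod.ext_iff.1 h).2]

theorem cell_mem_of_norm_lt {x : Plane} (h : ‖x‖ < 3 / 2) :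
    cell x ∈ Icc (-3 : ℤ) 2 ×ˢ Icc (-3 : ℤ) 2 := by
  have floor_mem (a : Fin 2) : ⌊2 * x a⌋ ∈ Icc (-3 : ℤ) 2 := by
    have hlt := abs_lt.1 ((PiLp.norm_apply_le x a).trans_lt h)
    rw [mem_Icc, Int.le_floor, ← Int.lt_add_one_iff, Int.floor_lt]
    constructor <;> push_cast <;> linarith
  exact mem_product.2 ⟨floor_mem 0, floor_mem 1⟩

open Classical in
theorem card_dist_lt_le (C : ι → Plane) {m : ℕ} (hm : ∀ j, #{l | dist (C j) (C l) ≤ 3 / 4} ≤ m)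
    (i : ι) : #{j | dist (C i) (C j) < 3 / 2} ≤ m * 36 := by
  have card_cells : #(Icc (-3 : ℤ) 2 ×ˢ Icc (-3 : ℤ) 2) = 36 := by decide
  rw [← card_cells]
  refine card_le_mul_card_image_of_maps_to (f := fun j => cell (C j - C i)) (fun j hj => ?_) m
    fun b _ => ?_
  · rw [mem_filter_univ, dist_comm, dist_eq_norm] at hj
    exact cell_mem_of_norm_lt hj
  · rcases eq_empty_or_nonempty {j ∈ {j | dist (C i) (C j) < 3 / 2} | cell (C j - C i) = b}
      with hempty | ⟨j, hj⟩
    · rw [hempty, card_empty]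
      exact m.zero_le
    · refine (card_le_card fun l hl => ?_).trans (hm j)
      rw [mem_filter] at hj hl
      rw [mem_filter_univ, ← dist_sub_right _ _ (C i)]
      exact dist_le_of_cell_eq (hj.2.trans hl.2.symm)

open Classical in
theorem sub_card_le_sum_pairTerm (h : IsHardCorePotential r₀ fun r => w r) (C : ι → Plane)
    (i : ι) :
    73 * (#{j | i ≠ j ∧ dist (C i) (C j) ≤ 3 / 4} : ℝ) - #{j | i ≠ j ∧ dist (C i) (C j) ≤ r₀} ≤
      ∑ j, pairTerm w C i j := by
  simp only [card_filter, Nat.cast_sum, Nat.cast_ite, Nat.cast_one, Nat.cast_zero, mul_sum,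
    ← sum_sub_distrib]
  refine sum_le_sum fun j _ => ?_
  unfold pairTerm
  by_cases hij : i = j
  · simp [hij]
  have hneg : -1 ≤ w (dist (C i) (C j)) := EReal.coe_le_coe_iff.1 (h.neg_one_le dist_nonneg)
  simp only [ne_eq, hij, not_false_eq_true, true_and, if_true]
  by_cases hclose : dist (C i) (C j) ≤ 3 / 4
  · have hlarge : 73 < w (dist (C i) (C j)) :=
      EReal.coe_lt_coe_iff.1 (h.repulsive dist_nonneg hclose)
    rw [if_pos hclose]
    split_ifs <;> linarith
  · rw [if_neg hclose]
    split_ifs with hrange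
    · linarith
    · rw [EReal.coe_eq_zero.1 (h.eq_zero (not_le.1 hrange).le)]
      norm_num

-- At a particle with the most close neighbours, their repulsion outweighs all attraction.
open Classical in
theorem exists_removalEnergy_pos_of_close (h₂ : IsHardCorePotential r₀ fun r => w r)
    (h₃ : IsRightAnglePotential v₃) (C : ι → Plane) {i j : ι} (hij : i ≠ j)
    (hdist : dist (C i) (C j) ≤ 3 / 4) : ∃ a, 0 < removalEnergy w v₃ r₀ C a := by
  obtain ⟨a, -, hmax⟩ := exists_max_image univ (fun a => #{l | dist (C a) (C l) ≤ 3 / 4})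
    ⟨i, mem_univ i⟩
  refine ⟨a, ?_⟩
  set m := #{l | dist (C a) (C l) ≤ 3 / 4}
  have two_le : 2 ≤ m := by
    rw [← card_pair hij]
    refine (card_le_card fun l hl => ?_).trans (hmax i (mem_univ i))
    rw [mem_filter_univ]
    rcases mem_insert.1 hl with rfl | hl
    · rw [dist_self]
      norm_num
    · rwa [mem_singleton.1 hl]
  have others_card : #{l | a ≠ l ∧ dist (C a) (C l) ≤ 3 / 4} + 1 = m := by
    refine Eq.trans ?_ (card_erase_add_one (a := a) ?_)
    · congr 2
      ext l
      simp [eq_comm]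
    · rw [mem_filter_univ, dist_self]
      norm_num
  have range_card : #{l | a ≠ l ∧ dist (C a) (C l) ≤ r₀} ≤ m * 36 :=
    (card_le_card <| monotone_filter_right _ fun l _ hl => hl.2.trans_lt h₂.range_lt).trans
      (card_dist_lt_le C (fun l => hmax l (mem_univ l)) a)
  have triples_nonneg : 0 ≤ ∑ j, ∑ k, tripleTerm v₃ r₀ C a j k :=
    sum_nonneg fun j _ => sum_nonneg fun k _ => tripleTerm_nonneg h₃ C a j k
  have pairs_le := sub_card_le_sum_pairTerm h₂ C a
  rify at two_le others_card range_card
  unfold removalEnergy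
  linarith

end ClosePairs

section BadAngles

open InnerProductGeometry
open scoped Real

variable {ι : Type*}

theorem not_near_of_nearStraight {u v x : ℂ} (hu : NearStraight u x) (hv : NearStraight x v) :
    ¬(NearRight u v ∨ NearStraight u v) := by
  have angle_le : angle u v ≤ 1 / 5 := by
    have := angle_le_angle_add_angle u (-x) v
    rw [angle_neg_right, angle_neg_left] at this
    linarith [(abs_le.1 hu).1, (abs_le.1 hv).1]
  have hpi := Real.pi_gt_three
  rintro (h | h) <;> linarith [(abs_le.1 h).1]

theorem not_nearRight_of_nearRight {u v x : ℂ} (hu : u ≠ 0) (hv : v ≠ 0) (hx : x ≠ 0)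
    (hux : NearRight u x) (hvx : NearRight x v) : ¬NearRight u v := fun huv =>
  cliqueFree_three_orthogonalClasses _ <| SimpleGraph.is3Clique_triple_iff.2
    ⟨adj_sector_of_nearRight hu hx hux 0, adj_sector_of_nearRight hu hv huv 0,
      adj_sector_of_nearRight hx hv hvx 0⟩

open Classical in
theorem card_le_four_of_near {u : ι → ℂ} {Q : Finset ι} (hne : ∀ i ∈ Q, u i ≠ 0)
    (hnear : ∀ i ∈ Q, ∀ j ∈ Q, i ≠ j → NearRight (u i) (u j) ∨ NearStraight (u i) (u j)) :
    #Q ≤ 4 := by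
  rcases Q.eq_empty_or_nonempty with rfl | ⟨a, ha⟩
  · simp
  have straight_card : #{i ∈ Q.erase a | NearStraight (u i) (u a)} ≤ 1 := by
    refine card_le_one.2 fun i hi j hj => ?_
    rw [mem_filter, mem_erase] at hi hj
    by_contra hij
    exact not_near_of_nearStraight hi.2 hj.2.symm (hnear i hi.1.2 j hj.1.2 hij)
  have right_card : #{i ∈ Q.erase a | ¬NearStraight (u i) (u a)} ≤ 2 := by
    by_contra! hlt
    obtain ⟨i, hi, j, hj, k, hk, hij, hik, hjk⟩ := two_lt_card.1 hlt
    simp only [mem_filter, mem_erase] at hi hj hk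
    have straight {i j : ι} (hi : (i ≠ a ∧ i ∈ Q) ∧ ¬NearStraight (u i) (u a))
        (hj : (j ≠ a ∧ j ∈ Q) ∧ ¬NearStraight (u j) (u a)) (hij : i ≠ j) :
        NearStraight (u i) (u j) := by
      refine (hnear i hi.1.2 j hj.1.2 hij).resolve_left ?_
      exact not_nearRight_of_nearRight (hne i hi.1.2) (hne j hj.1.2) (hne a ha)
        ((hnear i hi.1.2 a ha hi.1.1).resolve_right hi.2)
        ((hnear j hj.1.2 a ha hj.1.1).resolve_right hj.2).symm
    exact not_near_of_nearStraight (straight hi hj hij) (straight hj hk hjk)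
      (.inr (straight hi hk hik))
  have := card_filter_add_card_filter_not (s := Q.erase a) fun i => NearStraight (u i) (u a)
  have := card_erase_add_one ha
  omega

open Classical in
theorem card_le_card_related_add {r : ι → ι → Prop} {N : Finset ι} {k : ℕ}
    (hr : ∀ Q ⊆ N, (∀ i ∈ Q, ∀ j ∈ Q, i ≠ j → ¬r i j) → #Q ≤ k) :
    #N ≤ #{i ∈ N | ∃ j ∈ N, i ≠ j ∧ r i j} + k := by
  rw [← card_filter_add_card_filter_not (s := N) fun i => ∃ j ∈ N, i ≠ j ∧ r i j]
  gcongr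
  refine hr _ (filter_subset _ _) fun i hi j hj hij hrij => ?_
  exact (mem_filter.1 hi).2 ⟨j, (mem_filter.1 hj).1, hij, hrij⟩

variable {r₀ : ℝ} {w v₃ : ℝ → ℝ}

/-- The angle at the particle `i` between `j` and `k` is close to neither `π / 2` nor `π`. -/
def IsSkew (C : ι → Plane) (i j k : ι) : Prop :=
  ¬(NearRight (toComplex (C j) - toComplex (C i)) (toComplex (C k) - toComplex (C i)) ∨
    NearStraight (toComplex (C j) - toComplex (C i)) (toComplex (C k) - toComplex (C i)))

open Classical in
theorem card_bonds_le (C : ι → Plane) (i : ι) {N : Finset ι}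
    (hN : ∀ j ∈ N, (bondGraph r₀ C).Adj i j) :
    #N ≤ #{j ∈ N | ∃ k ∈ N, j ≠ k ∧ IsSkew C i j k} + 4 :=
  card_le_card_related_add fun _ hQ hnear => card_le_four_of_near
    (fun j hj => sub_ne_zero.2 <| toComplex_injective.ne (hN j (hQ hj)).1.symm)
    fun j hj k hk hjk => not_not.1 (hnear j hj k hk hjk)

variable [Fintype ι]

open Classical in
theorem card_mul_twelve_le_sum_tripleTerm (h₃ : IsRightAnglePotential v₃) (C : ι → Plane) (i : ι)
    {N : Finset ι} (hN : ∀ j ∈ N, (bondGraph r₀ C).Adj i j) :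
    (#{j ∈ N | ∃ k ∈ N, j ≠ k ∧ IsSkew C i j k} * 12 : ℝ) ≤
      ∑ j, ∑ k, tripleTerm v₃ r₀ C i j k := by
  rw [← nsmul_eq_mul]
  refine (card_nsmul_le_sum _ (fun j => ∑ k, tripleTerm v₃ r₀ C i j k) 12 fun j hj => ?_).trans <|
    sum_le_univ_sum_of_nonneg fun j => sum_nonneg fun k _ => tripleTerm_nonneg h₃ C i j k
  obtain ⟨hj, k, hk, hjk, hskew⟩ := mem_filter.1 hj
  refine le_trans ?_ (single_le_sum (fun k _ => tripleTerm_nonneg h₃ C i j k) (mem_univ k))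
  rw [tripleTerm, if_pos ⟨hjk, hN j hj, hN k hk⟩]
  exact h₃.twelve_le_of_not_near (hN j hj).1.symm (hN k hk).1.symm hskew

open Classical in
theorem removalEnergy_pos_of_isSkew (h₂ : IsHardCorePotential r₀ fun r => w r)
    (h₃ : IsRightAnglePotential v₃) {C : ι → Plane} {i j k : ι}
    (hfar : ∀ l, i ≠ l → 3 / 4 < dist (C i) (C l)) (hij : (bondGraph r₀ C).Adj i j)
    (hik : (bondGraph r₀ C).Adj i k) (hjk : j ≠ k) (hskew : IsSkew C i j k) :
    0 < removalEnergy w v₃ r₀ C i := by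
  set N : Finset ι := {l | (bondGraph r₀ C).Adj i l}
  have adj (l : ι) (hl : l ∈ N) : (bondGraph r₀ C).Adj i l := (mem_filter_univ l).1 hl
  have card_bonds := card_bonds_le C i adj
  have triples_le := card_mul_twelve_le_sum_tripleTerm h₃ C i adj
  have card_skew_pos : 1 ≤ #{j ∈ N | ∃ k ∈ N, j ≠ k ∧ IsSkew C i j k} :=
    card_pos.2 ⟨j, mem_filter.2
      ⟨(mem_filter_univ j).2 hij, k, (mem_filter_univ k).2 hik, hjk, hskew⟩⟩
  have pairs_le := sub_card_le_sum_pairTerm h₂ C i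
  have range_card : #{l | i ≠ l ∧ dist (C i) (C l) ≤ r₀} ≤ #N :=
    card_le_card <| monotone_filter_right _ fun l _ hl =>
      ⟨dist_pos.1 ((by norm_num : (0 : ℝ) < 3 / 4).trans (hfar l hl.1)), hl.2⟩
  rify at card_bonds card_skew_pos range_card
  unfold removalEnergy
  linarith

end BadAngles

section MinEnergy

/-- The least energy of `n` particles. -/
noncomputable def minEnergy (n : ℕ) : ℝ := -2 * n + ⌈2 * √(n : ℝ)⌉

theorem ceil_two_mul_sqrt_le_iff {n : ℕ} {a : ℤ} (ha : 0 ≤ a) :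
    ⌈2 * √(n : ℝ)⌉ ≤ a ↔ (4 * n : ℤ) ≤ a ^ 2 := by
  rw [Int.ceil_le, ← le_div_iff₀' two_pos, Real.sqrt_le_left (by positivity), div_pow,
    le_div_iff₀' (by norm_num)]
  norm_num [← @Int.cast_le ℝ]

theorem ceil_two_mul_sqrt_nonneg (n : ℕ) : 0 ≤ ⌈2 * √(n : ℝ)⌉ := Int.ceil_nonneg (by positivity)

theorem four_mul_le_ceil_sq (n : ℕ) : (4 * n : ℤ) ≤ ⌈2 * √(n : ℝ)⌉ ^ 2 :=
  (ceil_two_mul_sqrt_le_iff (ceil_two_mul_sqrt_nonneg n)).1 le_rfl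

theorem minEnergy_succ_le (n : ℕ) : minEnergy (n + 1) ≤ minEnergy n := by
  have nonneg := ceil_two_mul_sqrt_nonneg n
  have ceil_succ_le : ⌈2 * √((n + 1 : ℕ) : ℝ)⌉ ≤ ⌈2 * √(n : ℝ)⌉ + 2 := by
    rw [ceil_two_mul_sqrt_le_iff (by positivity)]
    push_cast
    nlinarith [four_mul_le_ceil_sq n]
  rify at ceil_succ_le
  unfold minEnergy
  push_cast at ceil_succ_le ⊢
  linarith

theorem minEnergy_add_lt {m n : ℕ} (hm : 0 < m) (hn : 0 < n) :
    minEnergy (m + n) < minEnergy m + minEnergy n := by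
  have two_le {k : ℕ} (hk : 0 < k) : 2 ≤ ⌈2 * √(k : ℝ)⌉ := by
    nlinarith [four_mul_le_ceil_sq k, ceil_two_mul_sqrt_nonneg k]
  have ceil_add_le : ⌈2 * √((m + n : ℕ) : ℝ)⌉ ≤ ⌈2 * √(m : ℝ)⌉ + ⌈2 * √(n : ℝ)⌉ - 1 := by
    rw [ceil_two_mul_sqrt_le_iff (by linarith [two_le hm, two_le hn])]
    push_cast
    nlinarith [four_mul_le_ceil_sq m, four_mul_le_ceil_sq n, two_le hm, two_le hn]
  rify at ceil_add_le
  unfold minEnergy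
  push_cast at ceil_add_le ⊢
  linarith

end MinEnergy

section Excess

variable {ι : Type*} {r₀ : ℝ} {w v₃ : ℝ → ℝ} {C : ι → Plane}

open Classical in
/-- The excess of a two-body term over the value `-1` for a bond. -/
noncomputable def pairExcess (w : ℝ → ℝ) (r₀ : ℝ) (C : ι → Plane) (i j : ι) : ℝ :=
  pairTerm w C i j + if (bondGraph r₀ C).Adj i j then 1 else 0

/-- The excess of a three-body term over the part that pays for a misaligned bond. -/
noncomputable def tripleExcess (v₃ : ℝ → ℝ) (r₀ : ℝ) (C : ι → Plane) (i j k : ι) : ℝ :=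
  tripleTerm v₃ r₀ C i j k - 5 / Real.pi * bondDefect (bondGraph r₀ C) (toComplex ∘ C) i j k

/-- All bonds have length `1` and all bond angles are nonzero multiples of `π / 2`. -/
structure IsExact (r₀ : ℝ) (C : ι → Plane) : Prop where
  injective : C.Injective
  dist_eq_one : ∀ {i j}, (bondGraph r₀ C).Adj i j → dist (C i) (C j) = 1
  clockwiseAngle_eq : ∀ {i j k}, j ≠ k → (bondGraph r₀ C).Adj i j → (bondGraph r₀ C).Adj i k →
    clockwiseAngle (C j) (C i) (C k) = Real.pi / 2 ∨ clockwiseAngle (C j) (C i) (C k) = Real.pi ∨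
      clockwiseAngle (C j) (C i) (C k) = 3 * Real.pi / 2

theorem pairTerm_of_adj {i j : ι} (h : (bondGraph r₀ C).Adj i j) :
    pairTerm w C i j = w (dist (C i) (C j)) :=
  if_pos h.ne

theorem pairTerm_pos_of_eq (h₂ : IsHardCorePotential r₀ fun r => w r) {i j : ι} (hij : i ≠ j)
    (heq : C i = C j) : 0 < pairTerm w C i j := by
  rw [pairTerm, if_pos hij, heq, dist_self]
  have := EReal.coe_lt_coe_iff.1 (h₂.repulsive le_rfl (by norm_num))
  linarith

theorem pairTerm_nonneg_of_not_adj (h₂ : IsHardCorePotential r₀ fun r => w r) {i j : ι}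
    (h : ¬(bondGraph r₀ C).Adj i j) : 0 ≤ pairTerm w C i j := by
  rcases eq_or_ne i j with rfl | hij
  · exact (pairTerm_self w C i).ge
  by_cases heq : C i = C j
  · exact (pairTerm_pos_of_eq h₂ hij heq).le
  · have hfar : r₀ ≤ dist (C i) (C j) := (not_le.1 fun hle => h ⟨heq, hle⟩).le
    rw [pairTerm, if_pos hij, EReal.coe_eq_zero.1 (h₂.eq_zero hfar)]

theorem pairExcess_nonneg (h₂ : IsHardCorePotential r₀ fun r => w r) (i j : ι) :
    0 ≤ pairExcess w r₀ C i j := by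
  unfold pairExcess
  split_ifs with h
  · rw [pairTerm_of_adj h]
    linarith [EReal.coe_le_coe_iff.1 (h₂.neg_one_le (dist_nonneg (x := C i) (y := C j)))]
  · rw [add_zero]
    exact pairTerm_nonneg_of_not_adj h₂ h

theorem tripleExcess_nonneg (h₃ : IsRightAnglePotential v₃) (i j k : ι) :
    0 ≤ tripleExcess v₃ r₀ C i j k :=
  sub_nonneg.2 (bondDefect_le_tripleTerm h₃ C i j k)

theorem isExact_of_excess_eq_zero (h₂ : IsHardCorePotential r₀ fun r => w r)
    (h₃ : IsRightAnglePotential v₃) (hpair : ∀ i j, pairExcess w r₀ C i j = 0)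
    (htriple : ∀ i j k, tripleExcess v₃ r₀ C i j k = 0) : IsExact r₀ C where
  injective i j heq := by
    by_contra hij
    have := hpair i j
    rw [pairExcess, if_neg fun h => h.1 heq, add_zero] at this
    exact (pairTerm_pos_of_eq h₂ hij heq).ne' this
  dist_eq_one {i j} hij := by
    have := hpair i j
    rw [pairExcess, if_pos hij, pairTerm_of_adj hij, add_eq_zero_iff_eq_neg] at this
    exact h₂.eq_one dist_nonneg (congrArg Real.toEReal this)
  clockwiseAngle_eq {i j k} hjk hij hik := by
    have := htriple i j k
    rw [tripleExcess, tripleTerm, if_pos ⟨hjk, hij, hik⟩, bondDefect, if_pos ⟨hjk, hij, hik⟩]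
      at this
    exact h₃.clockwiseAngle_eq hij.1.symm hik.1.symm (sub_eq_zero.1 this)

variable [Fintype ι]

/-- The half sum of all excesses of two-body and three-body terms. -/
noncomputable def totalExcess (w v₃ : ℝ → ℝ) (r₀ : ℝ) (C : ι → Plane) : ℝ :=
  1 / 2 * ∑ i, ∑ j, pairExcess w r₀ C i j + 1 / 2 * ∑ i, ∑ j, ∑ k, tripleExcess v₃ r₀ C i j k

theorem totalExcess_nonneg (h₂ : IsHardCorePotential r₀ fun r => w r)
    (h₃ : IsRightAnglePotential v₃) : 0 ≤ totalExcess w v₃ r₀ C :=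
  add_nonneg
    (mul_nonneg (by norm_num) (sum_nonneg fun i _ => sum_nonneg fun j _ =>
      pairExcess_nonneg h₂ i j))
    (mul_nonneg (by norm_num) (sum_nonneg fun i _ => sum_nonneg fun j _ => sum_nonneg fun k _ =>
      tripleExcess_nonneg h₃ i j k))

theorem isExact_of_totalExcess_eq_zero (h₂ : IsHardCorePotential r₀ fun r => w r)
    (h₃ : IsRightAnglePotential v₃) (h : totalExcess w v₃ r₀ C = 0) : IsExact r₀ C := by
  have pairs_nonneg : 0 ≤ fun i => ∑ j, pairExcess w r₀ C i j :=
    fun i => sum_nonneg fun j _ => pairExcess_nonneg h₂ i j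
  have triples_nonneg' (i : ι) : 0 ≤ fun j => ∑ k, tripleExcess v₃ r₀ C i j k :=
    fun j => sum_nonneg fun k _ => tripleExcess_nonneg h₃ i j k
  have triples_nonneg : 0 ≤ fun i => ∑ j, ∑ k, tripleExcess v₃ r₀ C i j k :=
    fun i => sum_nonneg fun j _ => triples_nonneg' i j
  obtain ⟨hpair, htriple⟩ := (add_eq_zero_iff_of_nonneg
    (mul_nonneg (by norm_num) (sum_nonneg fun i _ => pairs_nonneg i))
    (mul_nonneg (by norm_num) (sum_nonneg fun i _ => triples_nonneg i))).1 h
  rw [mul_eq_zero_iff_left (by norm_num), Fintype.sum_eq_zero_iff_of_nonneg pairs_nonneg] at hpair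
  rw [mul_eq_zero_iff_left (by norm_num), Fintype.sum_eq_zero_iff_of_nonneg triples_nonneg]
    at htriple
  refine isExact_of_excess_eq_zero h₂ h₃ (fun i => congrFun ?_) fun i j => congrFun ?_
  · exact (Fintype.sum_eq_zero_iff_of_nonneg (pairExcess_nonneg h₂ i)).1 (congrFun hpair i)
  · exact (Fintype.sum_eq_zero_iff_of_nonneg (tripleExcess_nonneg h₃ i j)).1
      (congrFun ((Fintype.sum_eq_zero_iff_of_nonneg (triples_nonneg' i)).1 (congrFun htriple i)) j)

open Classical in
theorem minEnergy_add_totalExcess_le (h : IsNearlySquare (bondGraph r₀ C) (toComplex ∘ C)) :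
    minEnergy (Fintype.card ι) + totalExcess w v₃ r₀ C ≤ realEnergy w v₃ r₀ C := by
  have bonds_card : (∑ i, ∑ j, if (bondGraph r₀ C).Adj i j then 1 else 0 : ℝ) =
      2 * #(bondGraph r₀ C).edgeFinset := by
    simp only [sum_boole, ← SimpleGraph.neighborFinset_eq_filter,
      SimpleGraph.card_neighborFinset_eq_degree]
    exact_mod_cast (bondGraph r₀ C).sum_degrees_eq_twice_card_edges
  have := h.ceil_add_card_edgeFinset_le
  simp only [totalExcess, pairExcess, tripleExcess, sum_add_distrib, sum_sub_distrib, ← mul_sum,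
    bonds_card]
  unfold minEnergy realEnergy
  linarith

theorem isNearlySquare_of_removalEnergy_nonpos (h₂ : IsHardCorePotential r₀ fun r => w r)
    (h₃ : IsRightAnglePotential v₃) (h : ∀ i, removalEnergy w v₃ r₀ C i ≤ 0) :
    IsNearlySquare (bondGraph r₀ C) (toComplex ∘ C) where
  ne hij := toComplex_injective.ne hij.1
  nearRight_or_nearStraight {i j k} hij hik hjk := by
    have hfar (l : ι) (hil : i ≠ l) : 3 / 4 < dist (C i) (C l) := by
      by_contra! hclose
      obtain ⟨a, ha⟩ := exists_removalEnergy_pos_of_close h₂ h₃ C hil hclose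
      exact ha.not_ge (h a)
    by_contra hskew
    exact (removalEnergy_pos_of_isSkew h₂ h₃ hfar hij hik hjk hskew).not_ge (h i)

end Excess

section LowerBound

universe u

variable {ι : Type u} [Fintype ι] {r₀ : ℝ} {w v₃ : ℝ → ℝ} {C : ι → Plane}

theorem minEnergy_add_removalEnergy_le [DecidableEq ι] (h₃ : IsRightAnglePotential v₃) {i : ι}
    (h : minEnergy (Fintype.card ({i}ᶜ : Finset ι)) ≤
      realEnergy w v₃ r₀ (C ∘ ((↑) : ({i}ᶜ : Finset ι) → ι))) :
    minEnergy (Fintype.card ι) + removalEnergy w v₃ r₀ C i ≤ realEnergy w v₃ r₀ C := by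
  have := minEnergy_succ_le (Fintype.card ({i}ᶜ : Finset ι))
  rw [Fintype.card_coe, card_compl, card_singleton,
    Nat.sub_add_cancel (Fintype.card_pos_iff.2 ⟨i⟩)] at this
  rw [Fintype.card_coe, card_compl, card_singleton] at h
  linarith [realEnergy_compl_singleton_add_le (w := w) (r₀ := r₀) h₃ C i]

theorem minEnergy_le_realEnergy (h₂ : IsHardCorePotential r₀ fun r => w r)
    (h₃ : IsRightAnglePotential v₃) (C : ι → Plane) :
    minEnergy (Fintype.card ι) ≤ realEnergy w v₃ r₀ C := by
  classical
  induction hn : Fintype.card ι using Nat.strong_induction_on generalizing ι with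
  | _ n ih =>
    subst hn
    by_cases hremoval : ∀ i, removalEnergy w v₃ r₀ C i ≤ 0
    · exact (le_add_of_nonneg_right (totalExcess_nonneg h₂ h₃)).trans <|
        minEnergy_add_totalExcess_le (isNearlySquare_of_removalEnergy_nonpos h₂ h₃ hremoval)
    · push Not at hremoval
      obtain ⟨i, hi⟩ := hremoval
      have card_lt : Fintype.card ({i}ᶜ : Finset ι) < Fintype.card ι :=
        Fintype.card_subtype_lt (x := i) (by simp)
      have rest := ih _ card_lt (C ∘ ((↑) : ({i}ᶜ : Finset ι) → ι)) rfl
      linarith [minEnergy_add_removalEnergy_le h₃ rest]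

theorem isExact_of_realEnergy_eq (h₂ : IsHardCorePotential r₀ fun r => w r)
    (h₃ : IsRightAnglePotential v₃) (h : realEnergy w v₃ r₀ C = minEnergy (Fintype.card ι)) :
    IsExact r₀ C := by
  classical
  have hremoval (i : ι) : removalEnergy w v₃ r₀ C i ≤ 0 := by
    linarith [minEnergy_add_removalEnergy_le h₃
      (minEnergy_le_realEnergy h₂ h₃ (C ∘ ((↑) : ({i}ᶜ : Finset ι) → ι)))]
  refine isExact_of_totalExcess_eq_zero h₂ h₃ (le_antisymm ?_ (totalExcess_nonneg h₂ h₃))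
  linarith [minEnergy_add_totalExcess_le (w := w) (v₃ := v₃)
    (isNearlySquare_of_removalEnergy_nonpos h₂ h₃ hremoval)]

end LowerBound

section Connectivity

variable {ι : Type*} {r₀ : ℝ} {w v₃ : ℝ → ℝ} {C : ι → Plane}

theorem pairTerm_eq_zero_of_not_adj (h₂ : IsHardCorePotential r₀ fun r => w r) {i j : ι}
    (hC : C i ≠ C j) (hij : ¬(bondGraph r₀ C).Adj i j) : pairTerm w C i j = 0 := by
  unfold pairTerm
  split_ifs
  · exact EReal.coe_eq_zero.1 (h₂.eq_zero (le_of_not_ge fun hle => hij ⟨hC, hle⟩))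
  · rfl

variable [Fintype ι]

theorem minEnergy_add_minEnergy_le [DecidableEq ι] (h₂ : IsHardCorePotential r₀ fun r => w r)
    (h₃ : IsRightAnglePotential v₃) (hC : C.Injective) {S : Finset ι}
    (hS : ∀ i ∈ S, ∀ j ∈ Sᶜ, ¬(bondGraph r₀ C).Adj i j) :
    minEnergy #S + minEnergy #Sᶜ ≤ realEnergy w v₃ r₀ C := by
  have le_localEnergy (T : Finset ι) : minEnergy #T ≤ localEnergy w v₃ r₀ C T :=
    calc minEnergy #T = minEnergy (Fintype.card T) := by rw [Fintype.card_coe]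
      _ ≤ realEnergy w v₃ r₀ (C ∘ ((↑) : T → ι)) := minEnergy_le_realEnergy h₂ h₃ _
      _ ≤ localEnergy w v₃ r₀ C T := realEnergy_coe_le_localEnergy h₃ C T
  have cross_eq_zero : ∑ i ∈ S, ∑ j ∈ Sᶜ, pairTerm w C i j = 0 :=
    sum_eq_zero fun i hi => sum_eq_zero fun j hj => pairTerm_eq_zero_of_not_adj h₂
      (hC.ne (ne_of_mem_of_not_mem hi (mem_compl.1 hj))) (hS i hi j hj)
  rw [realEnergy_eq_localEnergy_add C S, cross_eq_zero, add_zero]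
  exact add_le_add (le_localEnergy S) (le_localEnergy Sᶜ)

theorem preconnected_bondGraph_of_realEnergy_eq (h₂ : IsHardCorePotential r₀ fun r => w r)
    (h₃ : IsRightAnglePotential v₃) (h : realEnergy w v₃ r₀ C = minEnergy (Fintype.card ι)) :
    (bondGraph r₀ C).Preconnected := by
  classical
  intro i j
  by_contra hij
  set S : Finset ι := {k | (bondGraph r₀ C).Reachable i k} with hS
  have hiS : i ∈ S := by simp [hS]
  have hjS : j ∈ Sᶜ := by simpa [hS] using hij
  have not_adj : ∀ k ∈ S, ∀ l ∈ Sᶜ, ¬(bondGraph r₀ C).Adj k l := by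
    simp only [hS, mem_compl, mem_filter_univ]
    exact fun k hk l hl hkl => hl (hk.trans hkl.reachable)
  have sum_le :=
    minEnergy_add_minEnergy_le h₂ h₃ (isExact_of_realEnergy_eq h₂ h₃ h).injective not_adj
  have lt_sum := minEnergy_add_lt (card_pos.2 ⟨i, hiS⟩) (card_pos.2 ⟨j, hjS⟩)
  rw [card_add_card_compl, ← h] at lt_sum
  exact lt_sum.not_ge sum_le

end Connectivity

section SquareLattice

open scoped Real

theorem exists_gaussianInt_of_clockwiseAngle {x y z : Plane} (hz : z ≠ y)
    (hdist : dist x y = dist z y) (hangle : clockwiseAngle x y z = π / 2 ∨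
      clockwiseAngle x y z = π ∨ clockwiseAngle x y z = 3 * π / 2) :
    ∃ a : GaussianInt, toComplex x - toComplex y = (toComplex z - toComplex y) * a := by
  obtain ⟨m, hm⟩ : ∃ m : ℕ, clockwiseAngle x y z = m * (π / 2) := by
    rcases hangle with h | h | h
    exacts [⟨1, by rw [h]; push_cast; ring⟩, ⟨2, by rw [h]; push_cast; ring⟩,
      ⟨3, by rw [h]; push_cast; ring⟩]
  have exp_eq : Complex.exp (clockwiseAngle x y z * Complex.I) = Complex.I ^ m := by
    calc Complex.exp (clockwiseAngle x y z * Complex.I)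
        = Complex.exp (m * (π / 2 * Complex.I)) := by
          rw [hm]
          push_cast
          rw [mul_assoc]
      _ = Complex.I ^ m := by rw [Complex.exp_nat_mul, Complex.exp_pi_div_two_mul_I]
  have hne := sub_ne_zero.2 (toComplex_injective.ne hz)
  have I_eq : ((⟨0, 1⟩ : GaussianInt) : ℂ) = Complex.I := by simp [GaussianInt.toComplex_def]
  refine ⟨⟨0, 1⟩ ^ m, ?_⟩
  rw [map_pow, I_eq, ← exp_eq, exp_clockwiseAngle_mul_I hz hdist, mul_div_cancel₀ _ hne]

variable {ι : Type*} {r₀ : ℝ} {C : ι → Plane}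

namespace IsExact

variable {i j k : ι}

theorem exists_gaussianInt (h : IsExact r₀ C) (hij : (bondGraph r₀ C).Adj i j)
    (hik : (bondGraph r₀ C).Adj i k) : ∃ a : GaussianInt,
      toComplex (C j) - toComplex (C i) = (toComplex (C k) - toComplex (C i)) * a := by
  rcases eq_or_ne j k with rfl | hjk
  · exact ⟨1, by simp⟩
  · refine exists_gaussianInt_of_clockwiseAngle hik.1.symm ?_ (h.clockwiseAngle_eq hjk hij hik)
    rw [dist_comm, h.dist_eq_one hij, dist_comm, h.dist_eq_one hik]

theorem exists_gaussianInt_of_reachable (h : IsExact r₀ C) {v : ℂ}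
    (hv : ∀ k, (bondGraph r₀ C).Adj i k →
      ∃ a : GaussianInt, toComplex (C k) - toComplex (C i) = v * a)
    (hij : (bondGraph r₀ C).Reachable i j) :
    (∃ a : GaussianInt, toComplex (C j) - toComplex (C i) = v * a) ∧
      ∀ k, (bondGraph r₀ C).Adj j k →
        ∃ a : GaussianInt, toComplex (C k) - toComplex (C j) = v * a := by
  rw [SimpleGraph.reachable_iff_reflTransGen] at hij
  induction hij with
  | refl => exact ⟨⟨0, by simp⟩, hv⟩
  | @tail j k _ hjk ih =>
    obtain ⟨⟨a, ha⟩, hj⟩ := ih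
    obtain ⟨b, hb⟩ := hj k hjk
    refine ⟨⟨a + b, ?_⟩, fun l hkl => ?_⟩
    · rw [map_add]
      linear_combination ha + hb
    · obtain ⟨c, hc⟩ := h.exists_gaussianInt hkl hjk.symm
      refine ⟨-(b * c), ?_⟩
      rw [map_neg, map_mul]
      linear_combination hc - c * hb

theorem exists_forall_gaussianInt (h : IsExact r₀ C) (hconn : (bondGraph r₀ C).Preconnected)
    (i : ι) : ∃ v : ℂ, ‖v‖ = 1 ∧
      ∀ j, ∃ a : GaussianInt, toComplex (C j) - toComplex (C i) = v * a := by
  obtain ⟨v, hv, hbond⟩ : ∃ v : ℂ, ‖v‖ = 1 ∧ ∀ k, (bondGraph r₀ C).Adj i k →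
      ∃ a : GaussianInt, toComplex (C k) - toComplex (C i) = v * a := by
    by_cases hisolated : ∃ j, (bondGraph r₀ C).Adj i j
    · obtain ⟨j, hij⟩ := hisolated
      refine ⟨toComplex (C j) - toComplex (C i), ?_, fun k hik => h.exists_gaussianInt hik hij⟩
      rw [← dist_eq_norm_toComplex_sub, dist_comm, h.dist_eq_one hij]
    · exact ⟨1, norm_one, fun k hik => absurd ⟨k, hik⟩ hisolated⟩
  exact ⟨v, hv, fun j => (h.exists_gaussianInt_of_reachable hbond (hconn i j)).1⟩

end IsExact

theorem orthonormalBasisOneI_repr_symm_eq_toComplex (x : Plane) :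
    Complex.orthonormalBasisOneI.repr.symm x = toComplex x := by
  rw [Complex.orthonormalBasisOneI_repr_symm_apply]
  apply Complex.ext <;> simp [toComplex]

theorem mem_squareLattice_of_toComplex_eq {x : Plane} {a : GaussianInt} (h : toComplex x = a) :
    x ∈ squareLattice := by
  rw [GaussianInt.toComplex_def] at h
  intro i
  fin_cases i
  · exact ⟨a.re, by simpa [toComplex] using congrArg Complex.re h⟩
  · exact ⟨a.im, by simpa [toComplex] using congrArg Complex.im h⟩

theorem exists_isometryEquiv_toComplex_eq {v : ℂ} (hv : ‖v‖ = 1) (z : ℂ) :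
    ∃ g : Plane ≃ᵢ Plane, ∀ x, toComplex (g x) = v⁻¹ * (toComplex x - z) := by
  let c : Circle := ⟨v, mem_sphere_zero_iff_norm.2 hv⟩
  let e : ℂ ≃ₗᵢ[ℝ] Plane := Complex.orthonormalBasisOneI.repr
  refine ⟨e.symm.toIsometryEquiv.trans ((IsometryEquiv.subRight z).trans
    ((rotation c⁻¹).toIsometryEquiv.trans e.toIsometryEquiv)), fun x => ?_⟩
  rw [← orthonormalBasisOneI_repr_symm_eq_toComplex, ← orthonormalBasisOneI_repr_symm_eq_toComplex]
  change e.symm (e ((rotation c⁻¹) (e.symm x - z))) = v⁻¹ * (e.symm x - z)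
  rw [e.symm_apply_apply, rotation_apply, Circle.coe_inv]

theorem exists_isometryEquiv_mem_squareLattice (h : IsExact r₀ C)
    (hconn : (bondGraph r₀ C).Preconnected) :
    ∃ g : Plane ≃ᵢ Plane, ∀ i, g (C i) ∈ squareLattice := by
  rcases isEmpty_or_nonempty ι with hι | ⟨⟨i₀⟩⟩
  · exact ⟨IsometryEquiv.refl _, hι.elim⟩
  obtain ⟨v, hv, hlattice⟩ := h.exists_forall_gaussianInt hconn i₀
  have hv₀ : v ≠ 0 := norm_ne_zero_iff.1 (by rw [hv]; exact one_ne_zero)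
  obtain ⟨g, hg⟩ := exists_isometryEquiv_toComplex_eq hv (toComplex (C i₀))
  refine ⟨g, fun i => ?_⟩
  obtain ⟨a, ha⟩ := hlattice i
  exact mem_squareLattice_of_toComplex_eq (by rw [hg, ha, inv_mul_cancel_left₀ hv₀])

end SquareLattice

section ExtendedEnergy

theorem coe_sum_ereal {α : Type*} (s : Finset α) (f : α → ℝ) :
    ((∑ a ∈ s, f a : ℝ) : EReal) = ∑ a ∈ s, (f a : EReal) :=
  map_sum (⟨⟨Real.toEReal, EReal.coe_zero⟩, EReal.coe_add⟩ : ℝ →+ EReal) f s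

variable {r₀ : ℝ} {v₂ : ℝ → EReal} {v₃ : ℝ → ℝ} {n : ℕ}

theorem IsHardCorePotential.coe_sum_pairTerm_le (h₂ : IsHardCorePotential r₀ v₂)
    (C : Fin n → Plane) :
    ((1 / 2 * ∑ i, ∑ j, pairTerm (truncate v₂) C i j : ℝ) : EReal) ≤ twoBodyEnergy v₂ C := by
  rw [EReal.coe_mul, coe_sum_ereal]
  simp only [coe_sum_ereal]
  unfold twoBodyEnergy pairTerm
  gcongr with i _ j _
  split_ifs
  exacts [h₂.coe_truncate_le dist_nonneg, le_rfl]

theorem IsHardCorePotential.coe_realEnergy_truncate_le (h₂ : IsHardCorePotential r₀ v₂)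
    (v₃ : ℝ → ℝ) (C : Fin n → Plane) :
    (realEnergy (truncate v₂) v₃ r₀ C : EReal) ≤ energy v₂ v₃ r₀ C := by
  have sum_tripleTerm :
      1 / 2 * ∑ i, ∑ j, ∑ k, tripleTerm v₃ r₀ C i j k = threeBodyEnergy v₃ r₀ C := by
    unfold threeBodyEnergy tripleTerm
    congr!
  rw [realEnergy, EReal.coe_add, sum_tripleTerm]
  exact add_le_add_left (h₂.coe_sum_pairTerm_le C) _

end ExtendedEnergy

end Crystallization

theorem theorem1_general {r₀ : ℝ} {v₂ : ℝ → EReal} {v₃ : ℝ → ℝ}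
    (h₂ : Crystallization.IsHardCorePotential r₀ v₂)
    (h₃ : Crystallization.IsRightAnglePotential v₃) {n : ℕ} (C : Fin n → Crystallization.Plane) :
    (((-2 * (n : ℝ) + (⌈2 * √(n : ℝ)⌉ : ℝ) : ℝ) : EReal) ≤
        Crystallization.energy v₂ v₃ r₀ C) ∧
      (Crystallization.energy v₂ v₃ r₀ C =
          ((-2 * (n : ℝ) + (⌈2 * √(n : ℝ)⌉ : ℝ) : ℝ) : EReal) →
        ∃ g : Crystallization.Plane ≃ᵢ Crystallization.Plane,
          ∀ i, g (C i) ∈ Crystallization.squareLattice) := by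
  open Crystallization in
  have hard_core := h₂.isHardCorePotential_truncate
  have truncate_le := h₂.coe_realEnergy_truncate_le v₃ C
  have lower := minEnergy_le_realEnergy hard_core h₃ C
  have minEnergy_eq : minEnergy (Fintype.card (Fin n)) = -2 * (n : ℝ) + ⌈2 * √(n : ℝ)⌉ := by
    rw [minEnergy, Fintype.card_fin]
  rw [← minEnergy_eq]
  refine ⟨(EReal.coe_le_coe lower).trans truncate_le, fun h => ?_⟩
  rw [h, EReal.coe_le_coe_iff] at truncate_le
  have attained := le_antisymm truncate_le lower
  exact exists_isometryEquiv_mem_squareLattice (isExact_of_realEnergy_eq hard_core h₃ attained)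
    (preconnected_bondGraph_of_realEnergy_eq hard_core h₃ attained)

theorem theorem1 :
    ∃ ε₀ : ℝ, 0 < ε₀ ∧ ε₀ < Real.pi / 6 ∧
      ∀ (ε r₀ : ℝ) (v₂ : ℝ → EReal) (v₃ : ℝ → ℝ), 0 < ε → ε < ε₀ →
        Crystallization.IsTwoBodyPotential ε r₀ v₂ →
        Crystallization.IsThreeBodyPotential ε v₃ →
        ∀ (n : ℕ) (C : Fin n → Crystallization.Plane),
          (((-2 * (n : ℝ) + (⌈2 * √(n : ℝ)⌉ : ℝ) : ℝ) : EReal) ≤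
              Crystallization.energy v₂ v₃ r₀ C) ∧
          (Crystallization.energy v₂ v₃ r₀ C =
              ((-2 * (n : ℝ) + (⌈2 * √(n : ℝ)⌉ : ℝ) : ℝ) : EReal) →
            ∃ g : Crystallization.Plane ≃ᵢ Crystallization.Plane,
              ∀ i, g (C i) ∈ Crystallization.squareLattice) :=
  ⟨1 / 100, by norm_num, by linarith [Real.pi_gt_three], fun _ _ _ _ hε hε' h₂ h₃ _ C =>
    theorem1_general (h₂.isHardCorePotential hε hε') (h₃.isRightAnglePotential hε hε') C⟩
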